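/- **Conventions.** $\mathbf K$ is an abstract elementary class with strong-submodel relation $\le$: a class of models of a fixed (set-sized) vocabulary $\tau$ with a binary relation $\le$ on it such that (i) $\mathbf K$ and $\le$ respect isomorphisms; (ii) $\le$ is reflexive and transitive and refines the submodel relation $\subseteq$; (iii) the union of a nonempty $\le$-increasing chain is in $\mathbf K$ and is a $\le$-extension of each member of the chain; (iv) if every member of a nonempty $\le$-increasing continuous chain is $\le N\in\mathbf K$, then so is its union; (v) if $A\subseteq B\subseteq C$, $A\le C$ and $B\le C$, then $A\le B$; (vi) there is a least infinite cardinal $\mathrm{LST}(\mathbf K)\ge|\tau|$ such that for every $N\in\mathbf K$ and $Z\subseteq N$ there is $M\le N$ with $Z\subseteq M$ and $|M|\le\max\{\mathrm{LST}(\mathbf K),|Z|\}$. Write $A<B$ for $A\le B$ and $A\ne B$, and $\mathbf K_\mu$ for the class of models in $\mathbf K$ of cardinality $\mu$. An embedding $f:A\to B$ is an isomorphism of $A$ onto some $f[A]\le B$. For $A\le B$ and $b\in B$, $\mathrm{tp}(b/A;B)$ is the Galois type, i.e. the class of $(B,b)$ under the equivalence relation generated by: $(B,b)\sim(C,c)$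 if there are $D\in\mathbf K$ and embeddings $f:B\to D$, $g:C\to D$ with $f\restriction A=g\restriction A$ and $f(b)=g(c)$. $S(A)$ is the class of all types over $A$, $S^{na}(A)$ the class of those $\mathrm{tp}(b/A;B)$ with $b\notin A$, and $\mathrm{tp}(b/B;C)\restriction A=\mathrm{tp}(b/A;C)$ for $A\le B\le C$. A *pre-$\lambda$-frame* is a triple $\mathfrak s=(\mathbf K,\mathrm{nf},S^{bs})$, where (1) $\lambda\ge\mathrm{LST}(\mathbf K)$ and $\mathbf K_\lambda\neq\emptyset$; (2) $S^{bs}(A)\subseteq S^{na}(A)$ for $A\in\mathbf K_\lambda$ (the basic types); (3) $\mathrm{nf}$ is a relation on quadruples $(A,B,c,C)$ with $A,B,C\in\mathbf K_\lambda$, $A\le B<C$, $c\in C\setminus B$; (4) $\mathrm{nf}$ and $S^{bs}$ are invariant under isomorphisms of $C$; (5) if $A\le A'\le B'\le B<C'\le C\le C''$ in $\mathbf K_\lambda$, $c\in C'\setminus B$ and $\mathrm{nf}(A,B,c,C)$, then $\mathrm{nf}(A',B',c,C')$ and $\mathrm{nf}(A',B',c,C'')$; (6) $\mathrm{nf}(A,A,c,C)$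 implies $\mathrm{tp}(c/A;C)\in S^{bs}(A)$. For $A\le B$ in $\mathbf K_\lambda$, $p\in S(B)$ *does not fork over $A$* if $p=\mathrm{tp}(c/B;C)$ for some $c,C$ with $\mathrm{nf}(A,B,c,C)$. For $N\in\mathbf K$ with $|N|>\lambda$ and $A\in\mathbf K_\lambda$ with $A\le N$, $p\in S(N)$ does not fork over $A$ if $p\restriction B$ does not fork over $A$ whenever $B\in\mathbf K_\lambda$ and $A\le B\le N$. The frame $\mathfrak s$ satisfies *amalgamation* if for all $A\le B$, $A\le C$ in $\mathbf K_\lambda$ there are $D\in\mathbf K_\lambda$ and embeddings $f:B\to D$, $g:C\to D$ with $f\restriction A=g\restriction A$; *transitivity* if, for $A\le B\le C$ in $\mathbf K_\lambda$ and $p\in S(C)$, whenever $p$ does not fork over $B$ and $p\restriction B$ does not fork over $A$, then $p$ does not fork over $A$; *extension* if for all $B\le C$ in $\mathbf K_\lambda$, every $p\in S^{bs}(B)$ is the restriction to $B$ of some $q\in S^{bs}(C)$ that does not fork over $B$; *continuity* if for every nonzero limit $\delta<\lambda^+$, every $\le$-increasing continuous $\langle A_\alpha\mid\alpha\le\delta\rangle$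 in $\mathbf K_\lambda$ and every $p\in S(A_\delta)$: if $p\restriction A_\alpha$ does not fork over $A_0$ for all $\alpha<\delta$, then $p\in S^{bs}(A_\delta)$ and $p$ does not fork over $A_0$. A *basic triple* is $(A,B,b)$ with $A<B$ in $\mathbf K_\lambda$, $b\in B\setminus A$ and $\mathrm{tp}(b/A;B)\in S^{bs}(A)$. It is a *uniqueness triple* if there are no $C,D,F\in\mathbf K_\lambda$ with $A<C$, $C\le D$, $C\le F$ and embeddings $f:B\to D$, $g:B\to F$ that are the identity on $A$ such that $\mathrm{tp}(f(b)/C;D)=\mathrm{tp}(g(b)/C;F)$, this type does not fork over $A$, and there are no $G\in\mathbf K$ and embeddings $u:D\to G$, $v:F\to G$ with $u\circ f=v\circ g$ and $u\restriction C=v\restriction C$. $N\in\mathbf K_{\lambda^+}$ is *saturated* (in $\lambda^+$ over $\lambda$) if for every $M\in\mathbf K_\lambda$ with $M<N$, every $p\in S(M)$ equals $\mathrm{tp}(b/M;N)$ for some $b\in N$. For $N<N'$ in $\mathbf K_{\lambda^+}$, $N'$ is *universal over $N$* if every $M\in\mathbf K_{\lambda^+}$ with $N\le M$ has an embedding into $N'$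 that is the identity on $N$. A *representation* of $N\in\mathbf K_{\lambda^+}$ is a $\le$-increasing continuous sequence $\langle A_\alpha\mid\alpha<\lambda^+\rangle$ of models in $\mathbf K_\lambda$ with union $N$. $\diamondsuit(\lambda^+)$ says that there are $S_\alpha\subseteq\alpha$ ($\alpha<\lambda^+$) such that for every $X\subseteq\lambda^+$ the set $\{\alpha<\lambda^+\mid X\cap\alpha=S_\alpha\}$ is stationary. **Theorem 14.1.** Suppose that $\lambda$ is an infinite cardinal such that $\diamondsuit(\lambda^+)$ holds; $\mathfrak s$ is a pre-$\lambda$-frame satisfying amalgamation, transitivity, extension and continuity; $(A,B,b)$ is a basic triple; and $N^\circ,N^\bullet\in\mathbf K_{\lambda^+}$ are such that $N^\circ$ is saturated, $A<N^\circ<N^\bullet$, and $N^\bullet$ is universal over $N^\circ$. Then there exist $N,N^+\in\mathbf K_{\lambda^+}$, representations $\langle A_\alpha\mid\alpha<\lambda^+\rangle$ of $N$ and $\langle B_\alpha\mid\alpha<\lambda^+\rangle$ of $N^+$, and an embedding $h:N^+\to N^\bullet$ such that: 1. $N<N^+$ and $b\in N^+\setminus N$; 2. $N$ is saturated in $\lambda^+$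 over $\lambda$; 3. $A_0=A$ and $B_0=B$; 4. $\mathrm{tp}(b/N;N^+)$ does not fork over $A$; 5. $(A_\alpha,B_\alpha,b)$ is a basic triple for every $\alpha<\lambda^+$; 6. $\{\alpha<\lambda^+\mid(A_\alpha,B_\alpha,b)\text{ is a uniqueness triple}\}$ is stationary in $\lambda^+$; 7. $h\restriction N$ is an isomorphism of $N$ onto $N^\circ$, and $h\restriction A=\mathrm{id}_A$. -/

import Mathlib

open FirstOrder FirstOrder.Language.Structure Cardinal

universe u

namespace AECFrame

/-! ### Models, submodels, images, unions -/

/-- A `τ`-model for the vocabulary `L`: its universe is a *set* of points of the set-theoretic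
universe (`ZFSet`), so that inclusions, unions and equalities of models have their literal
set-theoretic meaning. -/
structure Mod (L : FirstOrder.Language.{u, u}) where
  carrier : Set ZFSet.{u}
  small : Small.{u} carrier
  str : L.Structure carrier

variable {L : FirstOrder.Language.{u, u}}

instance : CoeSort (Mod L) (Type (u + 1)) := ⟨fun M => M.carrier⟩

attribute [instance] Mod.small Mod.str

/-- The submodel relation `A ⊆ B`. -/
structure Mod.IsSub (A B : Mod L) : Prop where
  subset : A.carrier ⊆ B.carrier
  map_fun : ∀ {n : ℕ} (f : L.Functions n) (x : Fin n → A),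
    Set.inclusion subset (funMap f x) = funMap f (Set.inclusion subset ∘ x)
  map_rel : ∀ {n : ℕ} (r : L.Relations n) (x : Fin n → A),
    RelMap r (Set.inclusion subset ∘ x) ↔ RelMap r x

/-- The inclusion map `id_A : A → B` of a submodel. -/
def Mod.incl {A B : Mod L} (h : A.IsSub B) : A ↪[L] B where
  toFun := Set.inclusion h.subset
  inj' := Set.inclusion_injective h.subset
  map_fun' := h.map_fun
  map_rel' := h.map_rel

/-- The image `f[A]` of a model under an embedding of structures: the set of values of `f`,
with the structure transported along `f`. -/
noncomputable def Mod.image {A B : Mod L} (f : A ↪[L] B) : Mod L where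
  carrier := Set.range fun a : A => (f a : ZFSet.{u})
  small := inferInstance
  str := (Equiv.ofInjective (fun a : A => (f a : ZFSet.{u}))
    (Subtype.val_injective.comp f.injective)).inducedStructure

/-- `φ[A]` for a submodel `A` of the domain of an isomorphism `φ : B ≅ C`. -/
noncomputable def Mod.isoImage {A B C : Mod L} (φ : B ≃[L] C) (h : A.IsSub B) : Mod L :=
  Mod.image (φ.toEmbedding.comp (Mod.incl h))

/-- `U` is the union of the models `A α`, `α < δ`. -/
def IsUnion (δ : Ordinal.{u}) (A : Ordinal.{u} → Mod L) (U : Mod L) : Prop :=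
  U.carrier = ⋃ α ∈ Set.Iio δ, (A α).carrier ∧ ∀ α < δ, (A α).IsSub U

/-- The sequence `⟨A α | α < δ⟩` is (weakly) increasing for the relation `le`. -/
def IsIncreasing (le : Mod L → Mod L → Prop) (δ : Ordinal.{u}) (A : Ordinal.{u} → Mod L) : Prop :=
  ∀ α β, α ≤ β → β < δ → le (A α) (A β)

/-- The sequence `⟨A α | α < δ⟩` is continuous: unions are taken at nonzero limits below `δ`. -/
def IsContinuous (δ : Ordinal.{u}) (A : Ordinal.{u} → Mod L) : Prop :=
  ∀ γ < δ, Order.IsSuccLimit γ → IsUnion γ A (A γ)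

/-! ### Abstract elementary classes -/

/-- `κ` is an infinite cardinal, at least the size of the vocabulary, for which the downward
Löwenheim–Skolem–Tarski property holds. -/
def IsLSTCardinal (mem : Mod L → Prop) (le : Mod L → Mod L → Prop) (κ : Cardinal.{u}) : Prop :=
  ℵ₀ ≤ κ ∧ L.card ≤ κ ∧ ∀ N : Mod L, mem N → ∀ Z : Set ZFSet.{u}, Z ⊆ N.carrier →
    ∃ M : Mod L, le M N ∧ Z ⊆ M.carrier ∧ #M ≤ max (Cardinal.lift.{u + 1} κ) #Z

/-- An abstract elementary class in the vocabulary `L`, with strong-submodel relation `le`. -/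
structure AEC (L : FirstOrder.Language.{u, u}) where
  mem : Mod L → Prop
  le : Mod L → Mod L → Prop
  mem_left : ∀ {A B}, le A B → mem A
  mem_right : ∀ {A B}, le A B → mem B
  isSub : ∀ {A B}, le A B → A.IsSub B
  mem_iso : ∀ {B C : Mod L}, mem B → (B ≃[L] C) → mem C
  le_iso : ∀ {A B C : Mod L} (h : le A B) (φ : B ≃[L] C), le (Mod.isoImage φ (isSub h)) C
  refl : ∀ {A}, mem A → le A A
  trans : ∀ {A B C}, le A B → le B C → le A C
  union : ∀ (δ : Ordinal.{u}) (A : Ordinal.{u} → Mod L), 0 < δ → IsIncreasing le δ A →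
    ∃ U, IsUnion δ A U ∧ mem U ∧ ∀ β < δ, le (A β) U
  smooth : ∀ (δ : Ordinal.{u}) (A : Ordinal.{u} → Mod L) (U N : Mod L), 0 < δ →
    IsIncreasing le δ A → IsContinuous δ A → IsUnion δ A U → mem N →
    (∀ α < δ, le (A α) N) → le U N
  coherence : ∀ {A B C : Mod L}, A.IsSub B → B.IsSub C → le A C → le B C → le A B
  lst : ∃ κ : Cardinal.{u}, IsLSTCardinal mem le κ

namespace AEC

variable (K : AEC L)

/-- The Löwenheim–Skolem–Tarski number `LST(K)`. -/
noncomputable def LST : Cardinal.{u} := sInf {κ | IsLSTCardinal K.mem K.le κ}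

/-- The strict relation: `A ≤ B` and `A ≠ B`. -/
def lt (A B : Mod L) : Prop := K.le A B ∧ A ≠ B

/-- `M ∈ K_μ`: a member of the class, of cardinality `μ`. -/
def InCard (μ : Cardinal.{u}) (M : Mod L) : Prop :=
  K.mem M ∧ #M = Cardinal.lift.{u + 1} μ

/-- `f` is a `K`-embedding: an isomorphism onto a strong submodel of the target. -/
def IsEmb {A B : Mod L} (f : A ↪[L] B) : Prop := K.le (Mod.image f) B

/-- The inclusion of a strong submodel is a `K`-embedding. -/
theorem isEmb_incl {A B : Mod L} (h : K.le A B) : K.IsEmb (Mod.incl (K.isSub h)) := by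
  have e : Mod.image (Mod.incl (K.isSub h))
      = Mod.isoImage (FirstOrder.Language.Equiv.refl L B) (K.isSub h) := by
    unfold Mod.isoImage
    congr 1
  unfold IsEmb
  rw [e]
  exact K.le_iso h _

/-- A representation of `N` in length `λ⁺`: an increasing continuous sequence of models in `K_λ`
with union `N`. -/
def IsRepresentation (lam : Cardinal.{u}) (A : Ordinal.{u} → Mod L) (N : Mod L) : Prop :=
  IsIncreasing K.le (Order.succ lam).ord A ∧ IsContinuous (Order.succ lam).ord A ∧
    (∀ α < (Order.succ lam).ord, K.InCard lam (A α)) ∧ IsUnion (Order.succ lam).ord A N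

/-! ### Amalgamations -/

/-- `(fB, fC, D)` is an amalgamation of `B` and `C` over `(A, gB, gC)`. -/
def IsAmalgamation {A B C D : Mod L} (gB : A ↪[L] B) (gC : A ↪[L] C)
    (fB : B ↪[L] D) (fC : C ↪[L] D) : Prop :=
  K.IsEmb gB ∧ K.IsEmb gC ∧ K.IsEmb fB ∧ K.IsEmb fC ∧ fB.comp gB = fC.comp gC

/-- The relation `E` between two amalgamations `(fBD, fCD, D)` and `(fBF, fCF, F)` of `B`, `C`. -/
def AmalgEquiv {B C D F : Mod L} (fBD : B ↪[L] D) (fCD : C ↪[L] D)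
    (fBF : B ↪[L] F) (fCF : C ↪[L] F) : Prop :=
  ∃ (G : Mod L) (fD : D ↪[L] G) (fF : F ↪[L] G), K.IsEmb fD ∧ K.IsEmb fF ∧
    fD.comp fBD = fF.comp fBF ∧ fD.comp fCD = fF.comp fCF

/-- The amalgamation property of `K_μ`. -/
def HasAmalgamation (μ : Cardinal.{u}) : Prop :=
  ∀ (A B C : Mod L) (hAB : K.le A B) (hAC : K.le A C),
    K.InCard μ A → K.InCard μ B → K.InCard μ C →
    ∃ (D : Mod L) (fB : B ↪[L] D) (fC : C ↪[L] D), K.InCard μ D ∧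
      K.IsAmalgamation (Mod.incl (K.isSub hAB)) (Mod.incl (K.isSub hAC)) fB fC

/-! ### Galois types -/

/-- A strong extension of `A` together with a point of it. -/
structure Pointed (A : Mod L) where
  ext : Mod L
  le : K.le A ext
  pt : ZFSet.{u}
  mem : pt ∈ ext.carrier

/-- Atomic equivalence: the two pointed extensions can be amalgamated over `A` in such a way that
the two points are identified. -/
def AtEquiv (A : Mod L) (x y : K.Pointed A) : Prop :=
  ∃ (D : Mod L) (f : x.ext ↪[L] D) (g : y.ext ↪[L] D),
    K.IsAmalgamation (Mod.incl (K.isSub x.le)) (Mod.incl (K.isSub y.le)) f g ∧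
    f ⟨x.pt, x.mem⟩ = g ⟨y.pt, y.mem⟩

/-- `S(A)`: the Galois types over `A`, that is, the classes of pointed extensions of `A` under the
equivalence relation generated by atomic equivalence. -/
def GType (A : Mod L) : Type (u + 1) := Quot (K.AtEquiv A)

variable {K}

/-- `tp(b/A; B)`. -/
def tp {A B : Mod L} (h : K.le A B) (b : ZFSet.{u}) (hb : b ∈ B.carrier) : K.GType A :=
  Quot.mk _ ⟨B, h, b, hb⟩

/-- The restriction `p ↾ A` of a type `p` over `B`, where `A ≤ B`. -/
def GType.restrict {A B : Mod L} (h : K.le A B) (p : K.GType B) : K.GType A :=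
  Quot.map (fun x : K.Pointed B => (⟨x.ext, K.trans h x.le, x.pt, x.mem⟩ : K.Pointed A))
    (by
      rintro x y ⟨D, f, g, ⟨_, _, hf, hg, hfg⟩, hpt⟩
      refine ⟨D, f, g, ⟨K.isEmb_incl (K.trans h x.le), K.isEmb_incl (K.trans h y.le), hf, hg, ?_⟩,
        hpt⟩
      exact FirstOrder.Language.Embedding.ext fun a =>
        DFunLike.congr_fun hfg (Mod.incl (K.isSub h) a)) p

/-- `p` is a non-algebraic type over `A`. -/
def GType.IsNonalgebraic {A : Mod L} (p : K.GType A) : Prop :=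
  ∃ (B : Mod L) (h : K.le A B) (b : ZFSet.{u}) (hb : b ∈ B.carrier),
    b ∉ A.carrier ∧ p = tp h b hb

variable (K)

/-! ### Saturated and universal models -/

/-- `N ∈ K_{λ⁺}` is saturated in `λ⁺` over `λ`: it realizes every type over every `M ∈ K_λ` that is
a proper strong submodel of `N`. -/
def IsSaturated (lam : Cardinal.{u}) (N : Mod L) : Prop :=
  K.InCard (Order.succ lam) N ∧ ∀ (M : Mod L) (h : K.le M N), K.InCard lam M → M ≠ N →
    ∀ p : K.GType M, ∃ (b : ZFSet.{u}) (hb : b ∈ N.carrier), p = tp h b hb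

/-- `N'` is universal over `N` (both in `K_μ`). -/
def IsUniversalOver (μ : Cardinal.{u}) (N N' : Mod L) : Prop :=
  K.InCard μ N ∧ K.InCard μ N' ∧ K.lt N N' ∧
    ∀ M : Mod L, K.InCard μ M → K.le N M →
      ∃ f : M ↪[L] N', K.IsEmb f ∧ ∀ x : M, (x : ZFSet.{u}) ∈ N.carrier → (f x : ZFSet.{u}) = x

end AEC

/-! ### Pre-`λ`-frames -/

/-- A pre-`λ`-frame on the abstract elementary class `K`. Only the values of `bs` at models in
`K_λ` matter; `nf A B c C` is the relation "`tp(c/B; C)` does not fork over `A`". -/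
structure PreFrame (K : AEC L) (lam : Cardinal.{u}) where
  aleph0_le : ℵ₀ ≤ lam
  lst_le : K.LST ≤ lam
  nonempty : ∃ A, K.InCard lam A
  bs : (A : Mod L) → Set (K.GType A)
  bs_nonalgebraic : ∀ A, K.InCard lam A → ∀ p ∈ bs A, p.IsNonalgebraic
  nf : Mod L → Mod L → ZFSet.{u} → Mod L → Prop
  nf_dom : ∀ {A B C c}, nf A B c C → K.InCard lam A ∧ K.InCard lam B ∧ K.InCard lam C ∧
    K.le A B ∧ K.lt B C ∧ c ∈ C.carrier ∧ c ∉ B.carrier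
  nf_iso : ∀ {A B C C' : Mod L} (hA : A.IsSub C) (hB : B.IsSub C) (φ : C ≃[L] C')
    (c : ZFSet.{u}) (hc : c ∈ C.carrier), nf A B c C →
    nf (Mod.isoImage φ hA) (Mod.isoImage φ hB) (φ ⟨c, hc⟩ : C') C'
  bs_iso : ∀ {B C C' : Mod L} (h : K.le B C) (φ : C ≃[L] C') (c : ZFSet.{u})
    (hc : c ∈ C.carrier), K.InCard lam B → K.InCard lam C → c ∉ B.carrier →
    AEC.tp h c hc ∈ bs B →
    AEC.tp (K.le_iso h φ) (φ ⟨c, hc⟩ : C') (φ ⟨c, hc⟩).2 ∈ bs (Mod.isoImage φ (K.isSub h))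
  mono : ∀ {A A' B' B C' C C'' : Mod L} {c : ZFSet.{u}},
    K.InCard lam A' → K.InCard lam B' → K.InCard lam C' → K.InCard lam C'' →
    K.le A A' → K.le A' B' → K.le B' B → K.lt B C' → K.le C' C → K.le C C'' →
    c ∈ C'.carrier → c ∉ B.carrier → nf A B c C → nf A' B' c C' ∧ nf A' B' c C''
  nf_basic : ∀ {A C : Mod L} (h : K.le A C) (c : ZFSet.{u}) (hc : c ∈ C.carrier),
    nf A A c C → AEC.tp h c hc ∈ bs A

namespace PreFrame

variable {K : AEC L} {lam : Cardinal.{u}} (s : PreFrame K lam)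

/-- The type `p` over `B ∈ K_λ` does not fork over `A`. -/
def DNF {B : Mod L} (p : K.GType B) (A : Mod L) : Prop :=
  ∃ (C : Mod L) (h : K.le B C) (c : ZFSet.{u}) (hc : c ∈ C.carrier),
    p = AEC.tp h c hc ∧ s.nf A B c C

/-- The type `p` over `N ∈ K_{>λ}` does not fork over `A ∈ K_λ`, where `A ≤ N`. -/
def BigDNF {N : Mod L} (p : K.GType N) (A : Mod L) : Prop :=
  K.InCard lam A ∧ Cardinal.lift.{u + 1} lam < #N ∧ K.le A N ∧
    ∀ (B : Mod L) (h : K.le B N), K.InCard lam B → K.le A B → s.DNF (p.restrict h) A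

/-- Transitivity of non-forking. -/
def Transitivity : Prop :=
  ∀ (A B C : Mod L) (h : K.le B C) (p : K.GType C),
    K.InCard lam A → K.InCard lam B → K.InCard lam C → K.le A B →
    s.DNF p B → s.DNF (p.restrict h) A → s.DNF p A

/-- The extension property. -/
def Extension : Prop :=
  ∀ (B C : Mod L) (h : K.le B C), K.InCard lam B → K.InCard lam C →
    ∀ p ∈ s.bs B, ∃ q ∈ s.bs C, q.restrict h = p ∧ s.DNF q B

/-- The continuity property. -/
def Continuity : Prop :=
  ∀ (δ : Ordinal.{u}) (A : Ordinal.{u} → Mod L), Order.IsSuccLimit δ →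
    δ < (Order.succ lam).ord → ∀ hinc : IsIncreasing K.le (Order.succ δ) A,
    IsContinuous (Order.succ δ) A → (∀ α ≤ δ, K.InCard lam (A α)) →
    ∀ p : K.GType (A δ),
      (∀ (α : Ordinal.{u}) (hα : α < δ),
        s.DNF (p.restrict (hinc α δ hα.le (Order.lt_succ δ))) (A 0)) →
      p ∈ s.bs (A δ) ∧ s.DNF p (A 0)

/-- `(A, B, b)` is a basic triple. -/
def IsBasicTriple (A B : Mod L) (b : ZFSet.{u}) : Prop :=
  K.InCard lam A ∧ K.InCard lam B ∧ A ≠ B ∧ b ∉ A.carrier ∧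
    ∃ (h : K.le A B) (hb : b ∈ B.carrier), AEC.tp h b hb ∈ s.bs A

/-- `C` witnesses the non-uniqueness of the triple `(A, B, b)`. -/
def WitnessesNonuniqueness (C A B : Mod L) (b : ZFSet.{u}) : Prop :=
  K.InCard lam C ∧ A ≠ C ∧
  ∃ (hAB : K.le A B) (hb : b ∈ B.carrier) (hAC : K.le A C)
    (D F : Mod L) (hCD : K.le C D) (hCF : K.le C F) (fD : B ↪[L] D) (fF : B ↪[L] F),
    K.InCard lam D ∧ K.InCard lam F ∧
    K.IsAmalgamation (Mod.incl (K.isSub hAB)) (Mod.incl (K.isSub hAC))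
      fD (Mod.incl (K.isSub hCD)) ∧
    K.IsAmalgamation (Mod.incl (K.isSub hAB)) (Mod.incl (K.isSub hAC))
      fF (Mod.incl (K.isSub hCF)) ∧
    ¬ K.AmalgEquiv fD (Mod.incl (K.isSub hCD)) fF (Mod.incl (K.isSub hCF)) ∧
    AEC.tp hCD (fD ⟨b, hb⟩ : D) (fD ⟨b, hb⟩).2 = AEC.tp hCF (fF ⟨b, hb⟩ : F) (fF ⟨b, hb⟩).2 ∧
    s.DNF (AEC.tp hCD (fD ⟨b, hb⟩ : D) (fD ⟨b, hb⟩).2) A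

/-- `(A, B, b)` is a uniqueness triple. -/
def IsUniquenessTriple (A B : Mod L) (b : ZFSet.{u}) : Prop :=
  s.IsBasicTriple A B b ∧ ¬ ∃ C : Mod L, s.WitnessesNonuniqueness C A B b

end PreFrame

/-! ### The diamond principle -/

/-- Jensen's `◇(κ)`: some sequence `⟨S α | α < κ⟩` with `S α ⊆ α` guesses every subset of `κ`
stationarily often. -/
def Diamond (κ : Cardinal.{u}) : Prop :=
  ∃ S : Ordinal.{u} → Set Ordinal.{u}, (∀ α < κ.ord, S α ⊆ Set.Iio α) ∧
    ∀ X : Set Ordinal.{u}, X ⊆ Set.Iio κ.ord →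
      IsStationary {α : Set.Iio κ.ord | X ∩ Set.Iio (α : Ordinal.{u}) = S α}

end AECFrame

namespace AECFrame

variable {L : FirstOrder.Language.{u, u}}

/-! ### Submodels and isomorphic copies -/

/-! A chain of pairs `P α ≤ Q α` of length `λ⁺` is built from `(A, B)`, keeping `tp(b/P α; Q α)`
non-forking over `A`, together with increasing embeddings `e α` of `P α` into the saturated model
`N₀`. Bookkeeping puts every point of `N₀` into the range of some `e α`, so on the union `N` of the
`P α` the maps glue to an isomorphism onto `N₀`. Extension and transitivity carry non-forking
through successors, continuity through limits.

Diamond makes uniqueness triples appear. All `Q α` live in one set `U` of size `λ⁺` fixed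
beforehand, so a map from the union `N'` of the `Q α` to `N₁` is coded by a subset of `λ⁺`, which
the diamond sequence guesses. Suppose that at stage `α` the guess is a map `k` on `Q α` and that `(P
α, Q α, b)` is not a uniqueness triple. Then there are two inequivalent amalgams of `Q α` with some
`C` over `P α`, with the same non-forking type of the image of `b`. Fix an extension of `e α` to
`C`. The two amalgams cannot both embed into `N₁` compatibly with `k` and this extension, since `N₁`
would then make them equivalent. The next stage absorbs one that does not embed
(`exists_not_extendable`), so no embedding of `Q (α+1)` into `N₁` extends both `k` and `e (α+1)`.

At the end, universality of `N₁` over `N₀` gives an embedding `F` of `N'` extending the isomorphism.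
At stationarily many `α` the guess is exactly `F` on `Q α`, and `F` restricted to `Q (α+1)` is a
forbidden embedding unless the triple at `α` is a uniqueness triple.

The carriers of the argument are `exists_not_extendable`, `exists_extension_mem`,
`exists_guessing_chain`, and model-homogeneity of saturated models (`IsSaturated.exists_extension`).
-/

theorem Mod.isSub_of_embedding {A B : Mod L} (f : A ↪[L] B)
    (hf : ∀ x, (f x : ZFSet.{u}) = x) : A.IsSub B := by
  have hs : A.carrier ⊆ B.carrier := fun x hx => by
    have := (f ⟨x, hx⟩).2
    rwa [hf] at this
  have hi : Set.inclusion hs = f := by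
    funext x
    exact Subtype.ext (hf x).symm
  refine ⟨hs, fun g x => ?_, fun r x => ?_⟩
  · rw [hi]; exact f.map_fun g x
  · rw [hi]; exact f.map_rel r x

theorem Mod.IsSub.refl (A : Mod L) : A.IsSub A :=
  Mod.isSub_of_embedding (FirstOrder.Language.Embedding.refl L A) fun _ => rfl

/-- An embedding whose values lie in the range of another one factors through it. -/
theorem Mod.exists_factor {A B C : Mod L} (f : A ↪[L] C) (g : B ↪[L] C)
    (h : ∀ x, ∃ y, g y = f x) : ∃ k : A ↪[L] B, ∀ x, g (k x) = f x := by
  choose k hk using h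
  have hkc : ∀ {n : ℕ} (x : Fin n → A), g ∘ (k ∘ x) = f ∘ x := fun x => funext fun i => hk (x i)
  refine ⟨⟨⟨k, fun x y hxy => f.injective ?_⟩, fun φ x => g.injective ?_, fun r x => ?_⟩, hk⟩
  · rw [← hk x, ← hk y, hxy]
  · change g (k _) = g (funMap φ (k ∘ x))
    rw [hk, g.map_fun, hkc, f.map_fun]
  · change RelMap r (k ∘ x) ↔ _
    rw [← g.map_rel, hkc, f.map_rel]

theorem Mod.IsSub.of_subset {A B C : Mod L} (hA : A.IsSub C) (hB : B.IsSub C)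
    (h : A.carrier ⊆ B.carrier) : A.IsSub B := by
  obtain ⟨k, hk⟩ := Mod.exists_factor (Mod.incl hA) (Mod.incl hB) fun x => ⟨⟨x, h x.2⟩, rfl⟩
  exact Mod.isSub_of_embedding k fun x => congrArg Subtype.val (hk x)

theorem Mod.IsSub.antisymm {A B : Mod L} (h : A.IsSub B) (h' : B.IsSub A) : A = B := by
  obtain ⟨c, hs, str⟩ := A
  obtain ⟨c', hs', str'⟩ := B
  obtain rfl : c = c' := h.subset.antisymm h'.subset
  have : str = str' := by
    refine FirstOrder.Language.Structure.ext ?_ ?_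
    · funext n f x
      exact h.map_fun f x
    · funext n r x
      exact propext (h.map_rel r x).symm
  subst this
  rfl

theorem Mod.IsSub.eq_of_carrier {A B C : Mod L} (hA : A.IsSub C) (hB : B.IsSub C)
    (h : A.carrier = B.carrier) : A = B :=
  (hA.of_subset hB h.subset).antisymm (hB.of_subset hA h.superset)

/-- The isomorphic copy of a model along an injection of its universe. -/
theorem Mod.exists_copy (B : Mod L) (j : B → ZFSet.{u}) (hj : Function.Injective j) :
    ∃ (B' : Mod L) (φ : B ≃[L] B'), B'.carrier = Set.range j ∧ ∀ x, (φ x : ZFSet.{u}) = j x := by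
  let e := Equiv.ofInjective j hj
  exact ⟨⟨Set.range j, inferInstance, e.inducedStructure⟩, e.inducedStructureEquiv, rfl,
    fun _ => rfl⟩

theorem Mod.exists_imageEquiv {A B : Mod L} (f : A ↪[L] B) :
    ∃ φ : A ≃[L] Mod.image f, ∀ x, (φ x : ZFSet.{u}) = f x :=
  ⟨(Equiv.ofInjective (fun a : A => (f a : ZFSet.{u}))
    (Subtype.val_injective.comp f.injective)).inducedStructureEquiv, fun _ => rfl⟩

theorem Mod.image_isSub {A B : Mod L} (f : A ↪[L] B) : (Mod.image f).IsSub B := by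
  obtain ⟨φ, hφ⟩ := Mod.exists_imageEquiv f
  refine Mod.isSub_of_embedding (f.comp φ.symm.toEmbedding) fun x => ?_
  rw [show f.comp φ.symm.toEmbedding x = f (φ.symm x) from rfl, ← hφ, φ.apply_symm_apply]

theorem Mod.image_eq {A B A' : Mod L} (f : A ↪[L] B) (h : A'.IsSub B)
    (hc : A'.carrier = Set.range fun x : A => (f x : ZFSet.{u})) : Mod.image f = A' :=
  (Mod.image_isSub f).eq_of_carrier h hc.symm

/-! ### Embeddings handled as total functions on the universe of sets, so that they can be composed,
restricted and glued freely -/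

namespace AEC

variable {K : AEC L}

theorem le_of_equiv {A B C A' : Mod L} (h : K.le A B) (φ : B ≃[L] C) (hA' : A'.IsSub C)
    (hc : A'.carrier = Set.range fun x : A => (φ (Mod.incl (K.isSub h) x) : ZFSet.{u})) :
    K.le A' C := by
  rw [← Mod.image_eq (φ.toEmbedding.comp (Mod.incl (K.isSub h))) hA' hc]
  exact K.le_iso h φ

variable (K)

/-- `F` restricts to a `K`-embedding of `A` into `B`. -/
def Emb (F : ZFSet.{u} → ZFSet.{u}) (A B : Mod L) : Prop :=
  ∃ f : A ↪[L] B, K.IsEmb f ∧ ∀ x, (f x : ZFSet.{u}) = F x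

variable {K}

theorem emb_iff {F : ZFSet.{u} → ZFSet.{u}} {A B : Mod L} : K.Emb F A B ↔
    ∃ (A' : Mod L) (φ : A ≃[L] A'), K.le A' B ∧ ∀ x, (φ x : ZFSet.{u}) = F x := by
  constructor
  · rintro ⟨f, hf, hF⟩
    obtain ⟨φ, hφ⟩ := Mod.exists_imageEquiv f
    exact ⟨_, φ, hf, fun x => (hφ x).trans (hF x)⟩
  · rintro ⟨A', φ, hA', hF⟩
    refine ⟨(Mod.incl (K.isSub hA')).comp φ.toEmbedding, ?_, hF⟩
    unfold IsEmb
    rwa [Mod.image_eq _ (K.isSub hA')]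
    ext y
    constructor
    · intro hy
      exact ⟨φ.symm ⟨y, hy⟩, congrArg Subtype.val (φ.apply_symm_apply ⟨y, hy⟩)⟩
    · rintro ⟨x, rfl⟩
      exact (φ x).2

theorem IsEmb.exists_emb {A B : Mod L} {f : A ↪[L] B} (hf : K.IsEmb f) :
    ∃ F, K.Emb F A B ∧ ∀ x, (f x : ZFSet.{u}) = F x := by
  classical
  have : ∀ x : A, (f x : ZFSet.{u}) =
      (fun z => if hz : z ∈ A.carrier then (f ⟨z, hz⟩ : ZFSet.{u}) else z) x := fun x => by
    simp [x.2]
  exact ⟨fun z => if hz : z ∈ A.carrier then (f ⟨z, hz⟩ : ZFSet.{u}) else z, ⟨f, hf, this⟩, this⟩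

theorem emb_id {A B : Mod L} (h : K.le A B) : K.Emb id A B :=
  ⟨_, K.isEmb_incl h, fun _ => rfl⟩

namespace Emb

variable {F G : ZFSet.{u} → ZFSet.{u}} {A B C : Mod L}

theorem congr (h : K.Emb F A B) (hFG : Set.EqOn F G A.carrier) : K.Emb G A B := by
  obtain ⟨f, hf, hF⟩ := h
  exact ⟨f, hf, fun x => (hF x).trans (hFG x.2)⟩

theorem mapsTo (h : K.Emb F A B) : Set.MapsTo F A.carrier B.carrier := by
  obtain ⟨f, hf, hF⟩ := h
  intro x hx
  rw [← hF ⟨x, hx⟩]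
  exact (f ⟨x, hx⟩).2

theorem injOn (h : K.Emb F A B) : Set.InjOn F A.carrier := by
  obtain ⟨f, hf, hF⟩ := h
  intro x hx y hy hxy
  rw [← hF ⟨x, hx⟩, ← hF ⟨y, hy⟩] at hxy
  exact congrArg Subtype.val (f.injective (Subtype.ext hxy))

theorem mem_right (h : K.Emb F A B) : K.mem B := by
  obtain ⟨A', φ, hA', hF⟩ := emb_iff.1 h
  exact K.mem_right hA'

theorem mem_left (h : K.Emb F A B) : K.mem A := by
  obtain ⟨A', φ, hA', hF⟩ := emb_iff.1 h
  exact K.mem_iso (K.mem_left hA') φ.symm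

theorem of_equiv {φ : A ≃[L] B} (hB : K.mem B) (hF : ∀ x, (φ x : ZFSet.{u}) = F x) :
    K.Emb F A B :=
  emb_iff.2 ⟨B, φ, K.refl hB, hF⟩

theorem exists_equiv (h : K.Emb F A B) (hs : Set.SurjOn F A.carrier B.carrier) :
    ∃ φ : A ≃[L] B, ∀ x, (φ x : ZFSet.{u}) = F x := by
  obtain ⟨A', φ, hA', hF⟩ := emb_iff.1 h
  have : A' = B := (K.isSub hA').eq_of_carrier (Mod.IsSub.refl B) <| by
    refine (K.isSub hA').subset.antisymm fun y hy => ?_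
    obtain ⟨x, hx, rfl⟩ := hs hy
    rw [← hF ⟨x, hx⟩]
    exact (φ ⟨x, hx⟩).2
  subst this
  exact ⟨φ, hF⟩

/-- The image of a `K`-embedding is a strong submodel, isomorphic to the domain. -/
theorem exists_image (h : K.Emb F A B) :
    ∃ A', K.le A' B ∧ A'.carrier = F '' A.carrier ∧ K.Emb F A A' := by
  obtain ⟨A', φ, hA', hF⟩ := emb_iff.1 h
  refine ⟨A', hA', ?_, of_equiv (K.mem_left hA') hF⟩
  ext y
  constructor
  · intro hy
    refine ⟨φ.symm ⟨y, hy⟩, (φ.symm ⟨y, hy⟩).2, ?_⟩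
    rw [← hF, φ.apply_symm_apply]
  · rintro ⟨x, hx, rfl⟩
    rw [← hF ⟨x, hx⟩]
    exact (φ ⟨x, hx⟩).2

/-- A strong submodel of the domain is mapped onto a strong submodel of the image. -/
theorem le_of_image (h : K.Emb F B C) (hAB : K.le A B) {A' : Mod L} (hA' : A'.IsSub C)
    (hc : A'.carrier = F '' A.carrier) : K.le A' C := by
  obtain ⟨B', φ, hB', hF⟩ := emb_iff.1 h
  have hs : A'.IsSub B' := hA'.of_subset (K.isSub hB') <| by
    rw [hc]
    rintro _ ⟨x, hx, rfl⟩
    have hx' := (K.isSub hAB).subset hx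
    rw [← hF ⟨x, hx'⟩]
    exact (φ ⟨x, hx'⟩).2
  refine K.trans (le_of_equiv hAB φ hs ?_) hB'
  rw [hc]
  ext y
  constructor
  · rintro ⟨x, hx, rfl⟩
    exact ⟨⟨x, hx⟩, hF _⟩
  · rintro ⟨x, rfl⟩
    exact ⟨x, x.2, (hF (Mod.incl (K.isSub hAB) x)).symm⟩

theorem comp (hG : K.Emb G B C) (hF : K.Emb F A B) : K.Emb (G ∘ F) A C := by
  obtain ⟨A', hA', hc, hAA'⟩ := hF.exists_image
  obtain ⟨f, hf, hfF⟩ := hF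
  obtain ⟨g, hg, hgG⟩ := id hG
  refine ⟨g.comp f, ?_, fun x => ?_⟩
  · refine hG.le_of_image hA' (Mod.image_isSub _) ?_
    rw [hc]
    ext y
    constructor
    · rintro ⟨x, rfl⟩
      exact ⟨F x, ⟨x, x.2, rfl⟩, by rw [← hfF, ← hgG]; rfl⟩
    · rintro ⟨_, ⟨x, hx, rfl⟩, rfl⟩
      exact ⟨⟨x, hx⟩, by rw [← hfF ⟨x, hx⟩, ← hgG]; rfl⟩
  · rw [Function.comp_apply, ← hfF, ← hgG]; rfl

theorem mono_left (h : K.Emb F B C) (hAB : K.le A B) : K.Emb F A C :=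
  h.comp (emb_id hAB)

theorem mono_right (h : K.Emb F A B) (hBC : K.le B C) : K.Emb F A C :=
  (emb_id hBC).comp h

/-- The inverse of a bijective `K`-embedding. -/
theorem inverse (h : K.Emb F A B) (hs : Set.SurjOn F A.carrier B.carrier)
    (hG : Set.LeftInvOn G F A.carrier) : K.Emb G B A := by
  obtain ⟨φ, hφ⟩ := h.exists_equiv hs
  refine of_equiv (φ := φ.symm) h.mem_left fun y => ?_
  obtain ⟨x, rfl⟩ := φ.surjective y
  rw [φ.symm_apply_apply, hφ, hG x.2]

/-- If `G` and `G ∘ F` are `K`-embeddings, then so is `F`. -/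
theorem of_comp (hG : K.Emb G B C) (hGF : K.Emb (G ∘ F) A C)
    (hF : Set.MapsTo F A.carrier B.carrier) : K.Emb F A B := by
  classical
  obtain ⟨B', hB', hBc, hBB'⟩ := hG.exists_image
  obtain ⟨A', hA', hAc, hAA'⟩ := hGF.exists_image
  have hsub : A'.carrier ⊆ B'.carrier := by
    rw [hAc, hBc]
    rintro _ ⟨x, hx, rfl⟩
    exact ⟨F x, hF hx, rfl⟩
  -- The two images are strong submodels of `C`, so coherence compares them there; the rest pulls
  -- this back along `G`.
  have hle : K.le A' B' :=
    K.coherence ((K.isSub hA').of_subset (K.isSub hB') hsub) (K.isSub hB') hA' hB'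
  by_cases hne : B.carrier.Nonempty
  · have : Nonempty ZFSet.{u} := ⟨hne.some⟩
    have hinv : Set.LeftInvOn (Function.invFunOn G B.carrier) G B.carrier :=
      hG.injOn.leftInvOn_invFunOn
    refine (((hBB'.inverse (by rw [hBc]; exact Set.surjOn_image _ _) hinv).mono_left hle).comp
      hAA').congr fun x hx => ?_
    exact hinv (hF hx)
  · have hBe : B'.carrier = ∅ := by
      rw [hBc, Set.not_nonempty_iff_eq_empty.1 hne, Set.image_empty]
    have hB0 : B.carrier = ∅ := Set.not_nonempty_iff_eq_empty.1 hne
    have hemb : K.Emb F B B' := hBB'.congr fun x hx => absurd ⟨x, hx⟩ hne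
    have hback : K.Emb id B' B := hemb.inverse (by rw [hBe]; exact Set.surjOn_empty _ _)
      fun x hx => absurd ⟨x, hx⟩ hne
    refine ((hback.mono_left hle).comp hAA').congr fun x hx => ?_
    exact absurd ⟨F x, hF hx⟩ hne

theorem le_of_id (h : K.Emb F A B) (hF : Set.EqOn F id A.carrier) : K.le A B := by
  obtain ⟨A', hA', hAc, hAA'⟩ := h.exists_image
  rw [hF.image_eq, Set.image_id] at hAc
  obtain ⟨f, -, hf⟩ := hAA'
  have : A.IsSub A' := Mod.isSub_of_embedding f fun x => (hf x).trans (hF x.2)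
  rwa [this.eq_of_carrier (Mod.IsSub.refl _) hAc.symm]

/-- The domain of a `K`-embedding may be identified with its image, the codomain being replaced by
an isomorphic copy with points in a given large set. -/
theorem exists_rename (h : K.Emb F A B) {U : Set ZFSet.{u}} (hAU : A.carrier ⊆ U)
    (hU : #B ≤ #(U \ A.carrier : Set ZFSet.{u})) :
    ∃ (B' : Mod L) (G : ZFSet.{u} → ZFSet.{u}), K.le A B' ∧ B'.carrier ⊆ U ∧ K.Emb G B B' ∧
      B'.carrier = G '' B.carrier ∧ Set.EqOn (G ∘ F) id A.carrier := by
  classical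
  obtain ⟨i⟩ := hU
  let P : B → Prop := fun y => ∃ x ∈ A.carrier, F x = y
  -- A point of the image of `F` returns to its preimage in `A`; every other point goes to a fresh
  -- one in `U \ A`. The two kinds of values cannot collide.
  let j : B → ZFSet.{u} := fun y => if hy : P y then hy.choose else (i y : ZFSet.{u})
  have hjP : ∀ y (hy : P y), j y ∈ A.carrier ∧ F (j y) = y := fun y hy => by
    simp only [j, dif_pos hy]
    exact hy.choose_spec
  have hjN : ∀ y, ¬ P y → j y = i y := fun y hy => by simp only [j, dif_neg hy]
  have hj : Function.Injective j := by
    intro y z hyz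
    by_cases hy : P y <;> by_cases hz : P z
    · exact Subtype.ext (by rw [← (hjP y hy).2, ← (hjP z hz).2, hyz])
    · have := (i z).2.2
      rw [← hjN z hz, ← hyz] at this
      exact absurd (hjP y hy).1 this
    · have := (i y).2.2
      rw [← hjN y hy, hyz] at this
      exact absurd (hjP z hz).1 this
    · rw [hjN y hy, hjN z hz] at hyz
      exact i.injective (Subtype.ext hyz)
  obtain ⟨B', φ, hB', hφ⟩ := B.exists_copy j hj
  let G : ZFSet.{u} → ZFSet.{u} := fun z => if hz : z ∈ B.carrier then j ⟨z, hz⟩ else z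
  have hGj : ∀ y : B, G y = j y := fun y => by simp only [G, dif_pos y.2, Subtype.coe_eta]
  have hemb : K.Emb G B B' :=
    of_equiv (K.mem_iso h.mem_right φ) fun x => (hφ x).trans (hGj x).symm
  have hid : Set.EqOn (G ∘ F) id A.carrier := by
    intro x hx
    have hy : P ⟨F x, h.mapsTo hx⟩ := ⟨x, hx, rfl⟩
    have := hjP _ hy
    rw [Function.comp_apply, hGj ⟨F x, h.mapsTo hx⟩]
    exact h.injOn this.1 hx this.2
  refine ⟨B', G, (hemb.comp h).le_of_id hid, ?_, hemb, ?_, hid⟩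
  · rw [hB']
    rintro _ ⟨y, rfl⟩
    by_cases hy : P y
    · exact hAU (hjP y hy).1
    · rw [hjN y hy]
      exact (i y).2.1
  · rw [hB']
    ext z
    constructor
    · rintro ⟨y, rfl⟩
      exact ⟨y, y.2, hGj y⟩
    · rintro ⟨y, hy, rfl⟩
      exact ⟨⟨y, hy⟩, (hGj ⟨y, hy⟩).symm⟩

end Emb

/-! ### Supply of fresh points -/

/-- Otherwise the whole universe of sets would be small, and the set of all sets would be a member
of itself. -/
theorem not_small_compl (s : Set ZFSet.{u}) [Small.{u} s] : ¬ Small.{u} (sᶜ : Set ZFSet.{u}) := by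
  intro h
  have : Small.{u} (Set.univ : Set ZFSet.{u}) := by
    rw [← Set.union_compl_self s]
    infer_instance
  have h2 : Small.{u} ZFSet.{u} := small_of_surjective (f := fun x : (Set.univ : Set ZFSet.{u}) =>
    (x : ZFSet.{u})) fun x => ⟨⟨x, trivial⟩, rfl⟩
  apply ZFSet.mem_irrefl (ZFSet.range fun x : Shrink.{u} ZFSet.{u} => (equivShrink _).symm x)
  exact ZFSet.mem_range.2 ⟨equivShrink _ _, Equiv.symm_apply_apply _ _⟩

theorem lift_le_mk_compl (s : Set ZFSet.{u}) [Small.{u} s] (κ : Cardinal.{u}) :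
    Cardinal.lift.{u + 1} κ ≤ #(sᶜ : Set ZFSet.{u}) := by
  by_contra! h
  apply not_small_compl s
  obtain ⟨μ, hμ⟩ := Cardinal.mem_range_lift_of_le h.le
  rw [Cardinal.small_iff_lift_mk_lt_univ, ← hμ]
  simpa using Cardinal.lift_lt_univ' μ

theorem mk_eq_lift (B : Mod L) : ∃ κ : Cardinal.{u}, #B = Cardinal.lift.{u + 1} κ :=
  ⟨#(Shrink.{u} B), by
    rw [← Cardinal.lift_id'.{u, u + 1} #B]
    exact Cardinal.lift_mk_eq'.2 ⟨equivShrink.{u} B⟩⟩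

theorem Emb.exists_rename' {F : ZFSet.{u} → ZFSet.{u}} {A B : Mod L} (h : K.Emb F A B) :
    ∃ (B' : Mod L) (G : ZFSet.{u} → ZFSet.{u}), K.le A B' ∧ K.Emb G B B' ∧
      B'.carrier = G '' B.carrier ∧ Set.EqOn (G ∘ F) id A.carrier := by
  obtain ⟨κ, hκ⟩ := mk_eq_lift B
  obtain ⟨B', G, h1, -, h2⟩ := h.exists_rename (Set.subset_univ _) (U := Set.univ) (by
    rw [hκ, ← Set.compl_eq_univ_sdiff]
    exact lift_le_mk_compl _ κ)
  exact ⟨B', G, h1, h2⟩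

end AEC

namespace AEC

variable {K : AEC L} {lam : Cardinal.{u}}

/-! ### Small submodels and amalgamation -/

theorem isLSTCardinal_LST : IsLSTCardinal K.mem K.le K.LST := csInf_mem K.lst

theorem exists_le_inCard (hlst : K.LST ≤ lam) {N : Mod L} (hN : K.mem N)
    (hcard : Cardinal.lift.{u + 1} lam ≤ #N) {Z : Set ZFSet.{u}} (hZ : Z ⊆ N.carrier)
    (hZc : #Z ≤ Cardinal.lift.{u + 1} lam) :
    ∃ M, K.le M N ∧ Z ⊆ M.carrier ∧ K.InCard lam M := by
  obtain ⟨h0, -, hL⟩ := isLSTCardinal_LST (K := K)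
  -- Löwenheim–Skolem only bounds the size from above; including a set `Y` of size `λ` makes it
  -- exactly `λ`.
  obtain ⟨Y, hY, hYc⟩ := Cardinal.le_mk_iff_exists_subset.1 hcard
  have hinf : ℵ₀ ≤ Cardinal.lift.{u + 1} lam := Cardinal.aleph0_le_lift.2 (h0.trans hlst)
  have hYZ : #(Y ∪ Z : Set ZFSet.{u}) ≤ Cardinal.lift.{u + 1} lam :=
    (Cardinal.mk_union_le _ _).trans (by rw [hYc]; exact Cardinal.add_le_of_le hinf le_rfl hZc)
  obtain ⟨M, hM, hsub, hMc⟩ := hL N hN (Y ∪ Z) (Set.union_subset hY hZ)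
  refine ⟨M, hM, Set.subset_union_right.trans hsub, K.mem_left hM, le_antisymm ?_ ?_⟩
  · exact hMc.trans (max_le (Cardinal.lift_le.2 hlst) hYZ)
  · rw [← hYc]
    exact Cardinal.mk_le_mk_of_subset (Set.subset_union_left.trans hsub)

theorem InCard.of_emb {F : ZFSet.{u} → ZFSet.{u}} {A B : Mod L} (hA : K.InCard lam A)
    (h : K.Emb F A B) (hc : B.carrier = F '' A.carrier) : K.InCard lam B :=
  ⟨h.mem_right, by rw [hc, Cardinal.mk_image_eq_of_injOn _ _ h.injOn, hA.2]⟩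

theorem InCard.mk_le {F : ZFSet.{u} → ZFSet.{u}} {A B : Mod L} (h : K.Emb F A B)
    (hA : K.InCard lam A) : Cardinal.lift.{u + 1} lam ≤ #B := by
  rw [← hA.2, ← Cardinal.mk_image_eq_of_injOn _ _ h.injOn]
  exact Cardinal.mk_le_mk_of_subset h.mapsTo.image_subset

/-- Amalgamation of arbitrary embeddings. -/
theorem HasAmalgamation.exists_emb (h : K.HasAmalgamation lam) {A B C : Mod L}
    {F G : ZFSet.{u} → ZFSet.{u}} (hF : K.Emb F A B) (hG : K.Emb G A C) (hA : K.InCard lam A)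
    (hB : K.InCard lam B) (hC : K.InCard lam C) :
    ∃ (D : Mod L) (F' G' : ZFSet.{u} → ZFSet.{u}), K.InCard lam D ∧ K.Emb F' B D ∧
      K.Emb G' C D ∧ Set.EqOn (F' ∘ F) (G' ∘ G) A.carrier := by
  obtain ⟨B', f, hAB', hf, hB'c, hfF⟩ := hF.exists_rename'
  obtain ⟨C', g, hAC', hg, hC'c, hgG⟩ := hG.exists_rename'
  obtain ⟨D, fB, fC, hD, -, -, hfB, hfC, he⟩ :=
    h A B' C' hAB' hAC' hA (hB.of_emb hf hB'c) (hC.of_emb hg hC'c)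
  obtain ⟨F', hF', hFv⟩ := hfB.exists_emb
  obtain ⟨G', hG', hGv⟩ := hfC.exists_emb
  refine ⟨D, F' ∘ f, G' ∘ g, hD, hF'.comp hf, hG'.comp hg, fun x hx => ?_⟩
  have h1 : f (F x) = x := hfF hx
  have h2 : g (G x) = x := hgG hx
  have h3 := congrArg Subtype.val (DFunLike.congr_fun he ⟨x, hx⟩)
  have h4 := hFv (Mod.incl (K.isSub hAB') ⟨x, hx⟩)
  have h5 := hGv (Mod.incl (K.isSub hAC') ⟨x, hx⟩)
  simp only [Function.comp_apply, h1, h2]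
  exact h4.symm.trans (h3.trans h5)

/-! ### Equality of Galois types -/

theorem atEquiv_iff {A : Mod L} {x y : K.Pointed A} : K.AtEquiv A x y ↔
    ∃ (D : Mod L) (F G : ZFSet.{u} → ZFSet.{u}), K.Emb F x.ext D ∧ K.Emb G y.ext D ∧
      Set.EqOn F G A.carrier ∧ F x.pt = G y.pt := by
  constructor
  · rintro ⟨D, f, g, ⟨-, -, hf, hg, he⟩, hpt⟩
    obtain ⟨F, hF, hFv⟩ := hf.exists_emb
    obtain ⟨G, hG, hGv⟩ := hg.exists_emb
    refine ⟨D, F, G, hF, hG, fun a ha => ?_, ?_⟩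
    · have h3 := congrArg Subtype.val (DFunLike.congr_fun he ⟨a, ha⟩)
      exact (hFv (Mod.incl (K.isSub x.le) ⟨a, ha⟩)).symm.trans
        (h3.trans (hGv (Mod.incl (K.isSub y.le) ⟨a, ha⟩)))
    · exact (hFv ⟨x.pt, x.mem⟩).symm.trans ((congrArg Subtype.val hpt).trans (hGv ⟨y.pt, y.mem⟩))
  · rintro ⟨D, F, G, ⟨f, hf, hF⟩, ⟨g, hg, hG⟩, he, hpt⟩
    refine ⟨D, f, g, ⟨K.isEmb_incl x.le, K.isEmb_incl y.le, hf, hg, ?_⟩, ?_⟩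
    · refine FirstOrder.Language.Embedding.ext fun a => Subtype.ext ?_
      exact (hF (Mod.incl (K.isSub x.le) a)).trans
        ((he a.2).trans (hG (Mod.incl (K.isSub y.le) a)).symm)
    · exact Subtype.ext ((hF ⟨x.pt, x.mem⟩).trans (hpt.trans (hG ⟨y.pt, y.mem⟩).symm))

theorem tp_eq_of_emb {A B C : Mod L} {F : ZFSet.{u} → ZFSet.{u}} (hAB : K.le A B) (hAC : K.le A C)
    (hF : K.Emb F B C) (hid : Set.EqOn F id A.carrier) {b c : ZFSet.{u}} (hb : b ∈ B.carrier)
    (hc : c ∈ C.carrier) (hbc : F b = c) : tp hAB b hb = tp hAC c hc :=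
  Quot.sound (atEquiv_iff.2 ⟨C, F, id, hF, emb_id (K.refl (K.mem_right hAC)), hid, hbc⟩)

theorem tp_eq_of_le {A B C : Mod L} (hAB : K.le A B) (hBC : K.le B C) {b : ZFSet.{u}}
    (hb : b ∈ B.carrier) :
    tp hAB b hb = tp (K.trans hAB hBC) b ((K.isSub hBC).subset hb) :=
  tp_eq_of_emb hAB _ (emb_id hBC) (fun _ _ => rfl) hb _ rfl

/-- Being algebraic is an invariant of the type: in an amalgam over `A`, a point identified with the
image of some `a ∈ A` must be `a` itself, by injectivity. -/
theorem mem_iff_of_tp_eq {A B C : Mod L} {hAB : K.le A B} {hAC : K.le A C} {b c : ZFSet.{u}}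
    {hb : b ∈ B.carrier} {hc : c ∈ C.carrier} (h : tp hAB b hb = tp hAC c hc) :
    b ∈ A.carrier ↔ c ∈ A.carrier := by
  let P : K.GType A → Prop := Quot.lift (fun x => x.pt ∈ A.carrier) <| by
    intro x y hxy
    obtain ⟨D, F, G, hF, hG, he, hpt⟩ := atEquiv_iff.1 hxy
    apply propext
    constructor
    · intro hx
      rw [he hx] at hpt
      rwa [← hG.injOn ((K.isSub y.le).subset hx) y.mem hpt]
    · intro hy
      rw [← he hy] at hpt
      rwa [hF.injOn x.mem ((K.isSub x.le).subset hy) hpt]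
  exact iff_of_eq (congrArg P h)

/-- Over a base in `K_λ`, equivalence of pointed extensions is witnessed by an amalgam of small
submodels. -/
theorem exists_emb_of_eqvGen (hlst : K.LST ≤ lam) (h : K.HasAmalgamation lam) {A : Mod L}
    (hA : K.InCard lam A) {x y : K.Pointed A} (hxy : Relation.EqvGen (K.AtEquiv A) x y) :
    ∀ x₀ y₀ : Mod L, K.InCard lam x₀ → K.InCard lam y₀ → K.le A x₀ → K.le A y₀ →
      K.le x₀ x.ext → K.le y₀ y.ext → x.pt ∈ x₀.carrier → y.pt ∈ y₀.carrier →
      ∃ (D : Mod L) (F G : ZFSet.{u} → ZFSet.{u}), K.InCard lam D ∧ K.Emb F x₀ D ∧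
        K.Emb G y₀ D ∧ Set.EqOn F G A.carrier ∧ F x.pt = G y.pt := by
  have hinf : ℵ₀ ≤ Cardinal.lift.{u + 1} lam :=
    Cardinal.aleph0_le_lift.2 ((isLSTCardinal_LST (K := K)).1.trans hlst)
  -- The amalgams behind atomic equivalence may have any size; the two small images are enclosed in
  -- a strong submodel of size `λ`.
  have base : ∀ (D x₀ y₀ : Mod L) (F G : ZFSet.{u} → ZFSet.{u}), K.InCard lam x₀ →
      K.InCard lam y₀ → K.Emb F x₀ D → K.Emb G y₀ D →
      ∃ D' : Mod L, K.InCard lam D' ∧ K.Emb F x₀ D' ∧ K.Emb G y₀ D' := by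
    intro D x₀ y₀ F G hx hy hF hG
    have hle : ∀ (z : Mod L) (H : ZFSet.{u} → ZFSet.{u}), K.InCard lam z →
        #(H '' z.carrier) ≤ Cardinal.lift.{u + 1} lam := fun z H hz =>
      Cardinal.mk_image_le.trans hz.2.le
    obtain ⟨M, hM, hZ, hMc⟩ := exists_le_inCard hlst hF.mem_right (hx.mk_le hF)
      (Z := F '' x₀.carrier ∪ G '' y₀.carrier)
      (Set.union_subset hF.mapsTo.image_subset hG.mapsTo.image_subset)
      ((Cardinal.mk_union_le _ _).trans (Cardinal.add_le_of_le hinf (hle _ _ hx) (hle _ _ hy)))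
    exact ⟨M, hMc, (emb_id hM).of_comp hF fun z hz => hZ (Or.inl ⟨z, hz, rfl⟩),
      (emb_id hM).of_comp hG fun z hz => hZ (Or.inr ⟨z, hz, rfl⟩)⟩
  induction hxy with
  | rel x y hxy =>
    intro x₀ y₀ hx hy hAx hAy hx' hy' _ _
    obtain ⟨D, F, G, hF, hG, he, hpt⟩ := atEquiv_iff.1 hxy
    obtain ⟨D', hD', hF', hG'⟩ := base D x₀ y₀ F G hx hy (hF.mono_left hx') (hG.mono_left hy')
    exact ⟨D', F, G, hD', hF', hG', he, hpt⟩
  | refl x =>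
    intro x₀ y₀ hx hy hAx hAy hx' hy' _ _
    obtain ⟨D', hD', hF', hG'⟩ := base x.ext x₀ y₀ id id hx hy (emb_id hx') (emb_id hy')
    exact ⟨D', id, id, hD', hF', hG', fun _ _ => rfl, rfl⟩
  | symm x y _ ih =>
    intro x₀ y₀ hx hy hAx hAy hx' hy' hpx hpy
    obtain ⟨D, F, G, hD, hF, hG, he, hpt⟩ := ih y₀ x₀ hy hx hAy hAx hy' hx' hpy hpx
    exact ⟨D, G, F, hD, hG, hF, he.symm, hpt.symm⟩
  | trans x y z _ _ ih1 ih2 =>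
    intro x₀ z₀ hx hz hAx hAz hx' hz' hpx hpz
    -- The middle extension may be too large for amalgamation in `K_λ`. It is cut down to a small
    -- `y₀` containing `A` and the point, over which the two amalgams are amalgamated. Quantifying
    -- over the small submodels in the statement leaves `y₀` free to be chosen here.
    obtain ⟨y₀, hy', hZ, hy⟩ := exists_le_inCard hlst (K.mem_right y.le) (hA.mk_le (emb_id y.le))
      (Z := A.carrier ∪ {y.pt})
      (Set.union_subset (K.isSub y.le).subset (Set.singleton_subset_iff.2 y.mem))
      ((Cardinal.mk_union_le _ _).trans (Cardinal.add_le_of_le hinf hA.2.le (by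
        rw [Cardinal.mk_singleton]; exact Cardinal.one_le_aleph0.trans hinf)))
    have hAy : K.le A y₀ := K.coherence ((K.isSub y.le).of_subset (K.isSub hy')
      (Set.subset_union_left.trans hZ)) (K.isSub hy') y.le hy'
    have hpy : y.pt ∈ y₀.carrier := hZ (Or.inr rfl)
    obtain ⟨D, F, G, hD, hF, hG, he, hpt⟩ := ih1 x₀ y₀ hx hy hAx hAy hx' hy' hpx hpy
    obtain ⟨D', F', G', hD', hF', hG', he', hpt'⟩ := ih2 y₀ z₀ hy hz hAy hAz hy' hz' hpy hpz
    obtain ⟨E, P, Q, hE, hP, hQ, hPQ⟩ := h.exists_emb hG hF' hy hD hD'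
    refine ⟨E, P ∘ F, Q ∘ G', hE, hP.comp hF, hQ.comp hG', fun a ha => ?_, ?_⟩
    · simp only [Function.comp_apply]
      rw [he ha, ← he' ha]
      exact hPQ ((K.isSub hAy).subset ha)
    · simp only [Function.comp_apply]
      rw [hpt, ← hpt']
      exact hPQ hpy

/-- Two extensions in `K_λ` realizing the same type can be amalgamated, so that one of them is
literally contained in the amalgam. -/
theorem exists_emb_of_tp_eq (hlst : K.LST ≤ lam) (h : K.HasAmalgamation lam) {A B C : Mod L}
    (hA : K.InCard lam A) (hB : K.InCard lam B) (hC : K.InCard lam C) {hAB : K.le A B}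
    {hAC : K.le A C} {b c : ZFSet.{u}} {hb : b ∈ B.carrier} {hc : c ∈ C.carrier}
    (ht : tp hAB b hb = tp hAC c hc) :
    ∃ (D : Mod L) (G : ZFSet.{u} → ZFSet.{u}), K.InCard lam D ∧ K.le B D ∧ K.Emb G C D ∧
      Set.EqOn G id A.carrier ∧ G c = b := by
  obtain ⟨D, F, G, hD, hF, hG, he, hpt⟩ := exists_emb_of_eqvGen hlst h hA (Quot.eqvGen_exact ht)
    B C hB hC hAB hAC (K.refl hB.1) (K.refl hC.1) hb hc
  obtain ⟨D', H, hBD', hH, hD'c, hHF⟩ := hF.exists_rename'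
  refine ⟨D', H ∘ G, hD.of_emb hH hD'c, hBD', hH.comp hG, fun a ha => ?_, ?_⟩
  · rw [Function.comp_apply, ← he ha]
    exact hHF ((K.isSub hAB).subset ha)
  · rw [Function.comp_apply, ← show F b = G c from hpt]
    exact hHF hb

end AEC

/-! ### Non-forking -/

namespace PreFrame

variable {K : AEC L} {lam : Cardinal.{u}} {s : PreFrame K lam}

open AEC

/-- Isomorphism invariance moves the quadruple to `F[C]`, and monotonicity then enlarges the ambient
model to `D`. -/
theorem nf_emb {A B C D A' B' : Mod L} {c : ZFSet.{u}} {F : ZFSet.{u} → ZFSet.{u}}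
    (h : s.nf A B c C) (hF : K.Emb F C D) (hD : K.InCard lam D) (hA' : A'.IsSub D)
    (hA'c : A'.carrier = F '' A.carrier) (hB' : B'.IsSub D) (hB'c : B'.carrier = F '' B.carrier) :
    s.nf A' B' (F c) D := by
  obtain ⟨hA, hB, hC, hAB, hBC, hc, hcB⟩ := s.nf_dom h
  obtain ⟨C', hC'D, hC'c, hF'⟩ := hF.exists_image
  obtain ⟨φ, hφ⟩ := hF'.exists_equiv (by rw [hC'c]; exact Set.surjOn_image _ _)
  have hAC := K.isSub (K.trans hAB hBC.1)
  have key : ∀ {X X' : Mod L} (hX : X.IsSub C), X'.IsSub D → X'.carrier = F '' X.carrier →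
      Mod.isoImage φ hX = X' := by
    intro X X' hX hX' hc
    have hsub : X'.IsSub C' := hX'.of_subset (K.isSub hC'D) <| by
      rw [hc, hC'c]; exact Set.image_mono hX.subset
    refine Mod.image_eq _ hsub ?_
    rw [hc]
    ext y
    constructor
    · rintro ⟨x, hx, rfl⟩
      exact ⟨⟨x, hx⟩, hφ (Mod.incl hX ⟨x, hx⟩)⟩
    · rintro ⟨x, rfl⟩
      exact ⟨x, x.2, (hφ (Mod.incl hX x)).symm⟩
  have h1 := s.nf_iso hAC (K.isSub hBC.1) φ c hc h
  rw [key hAC hA' hA'c, key (K.isSub hBC.1) hB' hB'c, hφ] at h1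
  obtain ⟨hA1, hB1, hC1, hAB1, hBC1, hc1, hcB1⟩ := s.nf_dom h1
  exact (s.mono hA1 hB1 hC1 hD (K.refl hA1.1) hAB1 (K.refl hB1.1) hBC1 (K.refl hC1.1) hC'D hc1
    hcB1 h1).2

theorem DNF.inCard {A B : Mod L} {p : K.GType B} (h : s.DNF p A) :
    K.InCard lam A ∧ K.InCard lam B ∧ K.le A B := by
  obtain ⟨C, hBC, c, hc, -, hnf⟩ := h
  have := s.nf_dom hnf
  exact ⟨this.1, this.2.1, this.2.2.2.1⟩

theorem DNF.mono {A A' B' B : Mod L} {p : K.GType B} (h : s.DNF p A) (hA' : K.InCard lam A')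
    (hB' : K.InCard lam B') (hAA' : K.le A A') (hAB' : K.le A' B') (hB'B : K.le B' B) :
    s.DNF (p.restrict hB'B) A' := by
  obtain ⟨C, hBC, c, hc, rfl, hnf⟩ := h
  obtain ⟨hA1, hB1, hC1, hAB1, hBC1, hc1, hcB1⟩ := s.nf_dom hnf
  exact ⟨C, K.trans hB'B hBC, c, hc, rfl, (s.mono hA' hB' hC1 hC1 hAA' hAB' hB'B hBC1
    (K.refl hC1.1) (K.refl hC1.1) hc1 hcB1 hnf).1⟩

theorem restrict_refl {B : Mod L} (h : K.le B B) (p : K.GType B) : p.restrict h = p := by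
  induction p using Quot.ind
  rfl

/-- Monotonicity raises the base from `A` to `B`, and non-forking over the domain itself gives a
basic type. -/
theorem DNF.mem_bs {A B : Mod L} {p : K.GType B} (h : s.DNF p A) : p ∈ s.bs B := by
  obtain ⟨hA, hB, hAB⟩ := h.inCard
  obtain ⟨C, hBC, c, hc, hp, hnf⟩ := h.mono hB hB hAB (K.refl hB.1) (K.refl hB.1)
  rw [restrict_refl] at hp
  rw [hp]
  exact s.nf_basic hBC c hc hnf

theorem DNF.notMem {A B C : Mod L} {hBC : K.le B C} {b : ZFSet.{u}} {hb : b ∈ C.carrier}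
    (h : s.DNF (tp hBC b hb) A) : b ∉ B.carrier := by
  obtain ⟨D, hBD, c, hc, hp, hnf⟩ := h
  rw [mem_iff_of_tp_eq hp]
  exact (s.nf_dom hnf).2.2.2.2.2.2

theorem dnf_of_nf {A B C : Mod L} {c : ZFSet.{u}} (h : s.nf A B c C) (hBC : K.le B C)
    (hc : c ∈ C.carrier) : s.DNF (tp hBC c hc) A :=
  ⟨C, hBC, c, hc, rfl, h⟩

theorem Extension.dnf_self (h : s.Extension) {B : Mod L} (hB : K.InCard lam B) {p : K.GType B}
    (hp : p ∈ s.bs B) : s.DNF p B := by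
  obtain ⟨q, -, hq, hd⟩ := h B B (K.refl hB.1) hB hB p hp
  rw [restrict_refl] at hq
  rwa [← hq]

theorem isBasicTriple_of_dnf {A B C : Mod L} {b : ZFSet.{u}} {hBC : K.le B C} (hC : K.InCard lam C)
    {hb : b ∈ C.carrier} (h : s.DNF (tp hBC b hb) A) : s.IsBasicTriple B C b := by
  have hbB := h.notMem
  refine ⟨h.inCard.2.1, hC, ?_, hbB, hBC, hb, h.mem_bs⟩
  rintro rfl
  exact hbB hb

/-- A non-forking type realized in a model of `K_λ` is realized in an extension of that model by a
non-forking quadruple. -/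
theorem DNF.exists_nf (hamalg : K.HasAmalgamation lam) {A B D : Mod L} {b : ZFSet.{u}}
    {hBD : K.le B D} {hb : b ∈ D.carrier} (hD : K.InCard lam D) (h : s.DNF (tp hBD b hb) A) :
    ∃ G, K.InCard lam G ∧ K.le D G ∧ s.nf A B b G := by
  obtain ⟨C, hBC, c, hc, hp, hnf⟩ := h
  obtain ⟨hA1, hB1, hC1, hAB1, hBC1, hc1, hcB1⟩ := s.nf_dom hnf
  obtain ⟨G, F, hG, hDG, hF, hid, hFc⟩ := exists_emb_of_tp_eq s.lst_le hamalg hB1 hD hC1 hp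
  have hidA : Set.EqOn F id A.carrier := hid.mono (K.isSub hAB1).subset
  refine ⟨G, hG, hDG, ?_⟩
  rw [← hFc]
  exact nf_emb hnf hF hG (K.isSub (K.trans (K.trans hAB1 hBD) hDG))
    (by rw [hidA.image_eq, Set.image_id]) (K.isSub (K.trans hBD hDG))
    (by rw [hid.image_eq, Set.image_id])

end PreFrame

/-! ### Unions of chains -/

theorem IsUnion.mem_iff {δ : Ordinal.{u}} {A : Ordinal.{u} → Mod L} {U : Mod L}
    (h : IsUnion δ A U) {x : ZFSet.{u}} : x ∈ U.carrier ↔ ∃ α < δ, x ∈ (A α).carrier := by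
  rw [h.1]
  simp

theorem IsUnion.mk_le {δ : Ordinal.{u}} {A : Ordinal.{u} → Mod L} {U : Mod L}
    (h : IsUnion δ A U) {κ : Cardinal.{u}} (hκ : ℵ₀ ≤ κ) (hδ : δ.card ≤ κ)
    (hA : ∀ α < δ, #(A α) ≤ Cardinal.lift.{u + 1} κ) : #U ≤ Cardinal.lift.{u + 1} κ := by
  have hinf : ℵ₀ ≤ Cardinal.lift.{u + 1} κ := Cardinal.aleph0_le_lift.2 hκ
  rw [h.1]
  refine (Cardinal.mk_biUnion_le _ _).trans (Cardinal.mul_le_of_le hinf ?_ ?_)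
  · rw [Cardinal.mk_Iio_ordinal]
    exact Cardinal.lift_le.2 hδ
  · exact ciSup_le' fun α => hA α α.2

namespace AEC

variable {K : AEC L} {lam : Cardinal.{u}}

/-- A function which embeds every member of a continuous chain also embeds the union. -/
theorem emb_union {δ : Ordinal.{u}} (hδ : Order.IsSuccLimit δ) {A : Ordinal.{u} → Mod L}
    {U V : Mod L} {e : ZFSet.{u} → ZFSet.{u}} (hinc : IsIncreasing K.le δ A)
    (hcont : IsContinuous δ A) (hU : IsUnion δ A U) (he : ∀ α < δ, K.Emb e (A α) V) :
    K.Emb e U V := by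
  classical
  have h0 : 0 < δ := hδ.bot_lt
  have hmaps : ∀ x : U, e x ∈ V.carrier := fun x => by
    obtain ⟨α, hα, hx⟩ := hU.mem_iff.1 x.2
    exact (he α hα).mapsTo hx
  -- Arities are finite, so a tuple from the union already lies in one member of the chain, where
  -- `e` is known to respect the structure.
  have htuple : ∀ {n : ℕ} (x : Fin n → U), ∃ (α : Ordinal.{u}) (hα : α < δ) (y : Fin n → A α),
      x = Set.inclusion (hU.2 α hα).subset ∘ y := by
    intro n x
    have : ∀ i, ∃ α < δ, (x i : ZFSet.{u}) ∈ (A α).carrier := fun i => hU.mem_iff.1 (x i).2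
    choose a ha hxa using this
    have hlt : Finset.univ.sup a < δ := (Finset.sup_lt_iff h0).2 fun i _ => ha i
    refine ⟨_, hlt, fun i => ⟨x i, (K.isSub (hinc (a i) _ (Finset.le_sup (Finset.mem_univ i))
      hlt)).subset (hxa i)⟩, ?_⟩
    funext i
    rfl
  let f : U ↪[L] V :=
    { toFun := fun x => ⟨e x, hmaps x⟩
      inj' := by
        intro x y hxy
        obtain ⟨α, hα, z, hz⟩ := htuple ![x, y]
        have hx : x = Set.inclusion (hU.2 α hα).subset (z 0) := congrFun hz 0
        have hy : y = Set.inclusion (hU.2 α hα).subset (z 1) := congrFun hz 1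
        rw [hx, hy] at hxy ⊢
        have := (he α hα).injOn (z 0).2 (z 1).2 (congrArg Subtype.val hxy)
        rw [Subtype.ext this]
      map_fun' := by
        intro n φ x
        obtain ⟨α, hα, y, rfl⟩ := htuple x
        obtain ⟨k, -, hk⟩ := he α hα
        rw [← (hU.2 α hα).map_fun]
        have h1 : (fun x : U => (⟨e x, hmaps x⟩ : V)) ∘ Set.inclusion (hU.2 α hα).subset ∘ y
            = k ∘ y := funext fun i => Subtype.ext (hk (y i)).symm
        rw [h1, ← k.map_fun]
        exact Subtype.ext (hk _).symm
      map_rel' := by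
        intro n r x
        obtain ⟨α, hα, y, rfl⟩ := htuple x
        obtain ⟨k, -, hk⟩ := he α hα
        rw [(hU.2 α hα).map_rel]
        have h1 : (fun x : U => (⟨e x, hmaps x⟩ : V)) ∘ Set.inclusion (hU.2 α hα).subset ∘ y
            = k ∘ y := funext fun i => Subtype.ext (hk (y i)).symm
        rw [h1, ← k.map_rel] }
  refine ⟨f, ?_, fun _ => rfl⟩
  -- The images of the members form a continuous chain of strong submodels of `V`; smoothness makes
  -- their union, the image of `U`, a strong submodel too. The value at `α ≥ δ` is a dummy.
  have himg : ∀ α, ∃ I : Mod L, α < δ → K.le I V ∧ I.carrier = e '' (A α).carrier := by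
    intro α
    by_cases hα : α < δ
    · obtain ⟨I, h1, h2, -⟩ := (he α hα).exists_image
      exact ⟨I, fun _ => ⟨h1, h2⟩⟩
    · exact ⟨U, fun h => absurd h hα⟩
  choose I hI using himg
  have hsubI : ∀ α β, α ≤ β → β < δ → (I α).IsSub (I β) := fun α β hαβ hβ => by
    refine (K.isSub (hI α (hαβ.trans_lt hβ)).1).of_subset (K.isSub (hI β hβ).1) ?_
    rw [(hI α (hαβ.trans_lt hβ)).2, (hI β hβ).2]
    exact Set.image_mono (K.isSub (hinc α β hαβ hβ)).subset
  have hcarrier : (Mod.image f).carrier = e '' U.carrier := by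
    ext y
    constructor
    · rintro ⟨x, rfl⟩
      exact ⟨x, x.2, rfl⟩
    · rintro ⟨x, hx, rfl⟩
      exact ⟨⟨x, hx⟩, rfl⟩
  have hunion : ∀ (γ : Ordinal.{u}) (W : Mod L) (X : Mod L), γ ≤ δ → IsUnion γ A W → X.IsSub V →
      X.carrier = e '' W.carrier → IsUnion γ I X := by
    intro γ W X hγ hW hX hXc
    have hc : X.carrier = ⋃ α ∈ Set.Iio γ, (I α).carrier := by
      rw [hXc, hW.1, Set.image_iUnion₂]
      exact Set.iUnion₂_congr fun α hα => (hI α (lt_of_lt_of_le hα hγ)).2.symm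
    refine ⟨hc, fun α hα => (K.isSub (hI α (hα.trans_le hγ)).1).of_subset hX ?_⟩
    rw [hc]
    exact Set.subset_biUnion_of_mem (u := fun α => (I α).carrier) hα
  refine K.smooth δ I _ V h0 (fun α β hαβ hβ => ?_) (fun γ hγ hlim => ?_)
    (hunion δ U _ le_rfl hU (Mod.image_isSub f) hcarrier) (he 0 h0).mem_right
    fun α hα => (hI α hα).1
  · exact K.coherence (hsubI α β hαβ hβ) (K.isSub (hI β hβ).1) (hI α (hαβ.trans_lt hβ)).1
      (hI β hβ).1
  · exact hunion γ (A γ) _ hγ.le (hcont γ hγ hlim) (K.isSub (hI γ hγ).1) (hI γ hγ).2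

theorem inCard_union {δ : Ordinal.{u}} {A : Ordinal.{u} → Mod L} {U : Mod L}
    (h : IsUnion δ A U) (hlam : ℵ₀ ≤ lam) (h0 : 0 < δ) (hδ : δ < (Order.succ lam).ord)
    (hA : ∀ α < δ, K.InCard lam (A α)) (hU : K.mem U) : K.InCard lam U := by
  refine ⟨hU, le_antisymm (h.mk_le hlam ?_ fun α hα => (hA α hα).2.le) ?_⟩
  · exact Order.lt_succ_iff.1 (Cardinal.lt_ord.1 hδ)
  · rw [← (hA 0 h0).2]
    exact Cardinal.mk_le_mk_of_subset (h.2 0 h0).subset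

end AEC

/-! ### Transfinite recursion -/

/-- Dependent choice along the ordinals. As `Good α σ` only looks at `σ` up to `α`, well-founded
recursion can choose a good next value whenever one exists, and induction shows that one exists at
every index below `θ`. -/
theorem exists_seq {St : Type*} [Nonempty St] (θ : Ordinal.{u})
    (Good : Ordinal.{u} → (Ordinal.{u} → St) → Prop)
    (hcongr : ∀ α σ τ, (∀ β ≤ α, σ β = τ β) → Good α σ → Good α τ)
    (h : ∀ α < θ, ∀ σ, (∀ β < α, Good β σ) → ∃ x, Good α (Function.update σ α x)) :
    ∃ σ, ∀ α < θ, Good α σ := by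
  classical
  let prev : (α : Ordinal.{u}) → ((β : Ordinal.{u}) → β < α → St) → Ordinal.{u} → St :=
    fun α p β => if hβ : β < α then p β hβ else Classical.arbitrary St
  let step : (α : Ordinal.{u}) → ((β : Ordinal.{u}) → β < α → St) → St := fun α p =>
    if hx : ∃ x, Good α (Function.update (prev α p) α x) then hx.choose
    else Classical.arbitrary St
  let σ : Ordinal.{u} → St := WellFounded.fix Ordinal.lt_wf step
  have hσ : ∀ α, σ α = step α fun β _ => σ β := fun α => WellFounded.fix_eq _ _ _
  refine ⟨σ, fun α => ?_⟩
  induction α using WellFoundedLT.induction with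
  | ind α ih =>
    intro hα
    have hprev : ∀ β < α, σ β = prev α (fun β _ => σ β) β := fun β hβ => by
      simp only [prev, dif_pos hβ]
    have hx : ∃ x, Good α (Function.update (prev α fun β _ => σ β) α x) :=
      h α hα _ fun β hβ => hcongr β σ _ (fun γ hγ => hprev γ (hγ.trans_lt hβ))
        (ih β hβ (hβ.trans hα))
    refine hcongr α _ _ (fun β hβ => ?_) hx.choose_spec
    obtain rfl | hβ := hβ.eq_or_lt
    · rw [Function.update_self, hσ]
      simp only [step, dif_pos hx]
    · rw [Function.update_of_ne hβ.ne, hprev β hβ]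

namespace AEC

/-! ### Chains of approximations -/

/-- A stage of a construction: two models and two functions, intended as embeddings `g` of `P` into
`Q` and `e` of `P` into a fixed model. -/
structure Stage (L : FirstOrder.Language.{u, u}) where
  P : Mod L
  Q : Mod L
  g : ZFSet.{u} → ZFSet.{u}
  e : ZFSet.{u} → ZFSet.{u}

namespace Stage

variable (K : AEC L) (lam : Cardinal.{u})

/-- One stage extends another. -/
structure Le (σ τ : Stage L) : Prop where
  P : K.le σ.P τ.P
  Q : K.le σ.Q τ.Q
  g : Set.EqOn τ.g σ.g σ.P.carrier
  e : Set.EqOn τ.e σ.e σ.P.carrier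

/-- The models of the stage are in `K_λ` and its functions are embeddings. -/
structure Valid (N : Mod L) (σ : Stage L) : Prop where
  P : K.InCard lam σ.P
  Q : K.InCard lam σ.Q
  g : K.Emb σ.g σ.P σ.Q
  e : K.Emb σ.e σ.P N

/-- Increasing continuous sequences of stages. -/
structure IsChain (θ : Ordinal.{u}) (σ : Ordinal.{u} → Stage L) : Prop where
  le : ∀ α β, α ≤ β → β < θ → Le K (σ α) (σ β)
  P : IsContinuous θ fun α => (σ α).P
  Q : IsContinuous θ fun α => (σ α).Q

variable {K lam}

theorem Le.trans {σ τ ρ : Stage L} (h : Le K σ τ) (h' : Le K τ ρ) : Le K σ ρ :=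
  ⟨K.trans h.P h'.P, K.trans h.Q h'.Q,
    fun _ hx => (h'.g ((K.isSub h.P).subset hx)).trans (h.g hx),
    fun _ hx => (h'.e ((K.isSub h.P).subset hx)).trans (h.e hx)⟩

theorem Valid.refl {N : Mod L} {σ : Stage L} (h : Valid K lam N σ) : Le K σ σ :=
  ⟨K.refl h.P.1, K.refl h.Q.1, fun _ _ => rfl, fun _ _ => rfl⟩

theorem IsChain.incP {θ : Ordinal.{u}} {σ : Ordinal.{u} → Stage L} (h : IsChain K θ σ) :
    IsIncreasing K.le θ fun α => (σ α).P := fun α β hαβ hβ => (h.le α β hαβ hβ).P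

theorem IsChain.incQ {θ : Ordinal.{u}} {σ : Ordinal.{u} → Stage L} (h : IsChain K θ σ) :
    IsIncreasing K.le θ fun α => (σ α).Q := fun α β hαβ hβ => (h.le α β hαβ hβ).Q

/-- Functions given coherently along a chain have a common extension. -/
theorem exists_glue {θ : Ordinal.{u}} {A : Ordinal.{u} → Mod L}
    (f : Ordinal.{u} → ZFSet.{u} → ZFSet.{u})
    (hf : ∀ α β, α ≤ β → β < θ → Set.EqOn (f β) (f α) (A α).carrier) :
    ∃ F : ZFSet.{u} → ZFSet.{u}, ∀ α < θ, Set.EqOn F (f α) (A α).carrier := by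
  classical
  let P : ZFSet.{u} → Ordinal.{u} → Prop := fun x α => α < θ ∧ x ∈ (A α).carrier
  refine ⟨fun x => if h : ∃ α, P x α then f h.choose x else x, fun α hα x hx => ?_⟩
  have h : ∃ α, P x α := ⟨α, hα, hx⟩
  obtain ⟨h1, h2⟩ := h.choose_spec
  simp only [dif_pos h]
  obtain hle | hle := le_total h.choose α
  · exact (hf _ _ hle hα h2).symm
  · exact hf _ _ hle h1 hx

/-- A chain of stages of limit length has an upper bound, given by unions. -/
theorem IsChain.exists_union {δ : Ordinal.{u}} (hδ : Order.IsSuccLimit δ) {N : Mod L}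
    {σ : Ordinal.{u} → Stage L} (h : IsChain K δ σ) (hv : ∀ α < δ, Valid K lam N (σ α)) :
    ∃ τ : Stage L, (∀ α < δ, Le K (σ α) τ) ∧ IsUnion δ (fun α => (σ α).P) τ.P ∧
      IsUnion δ (fun α => (σ α).Q) τ.Q ∧ K.Emb τ.g τ.P τ.Q ∧ K.Emb τ.e τ.P N := by
  obtain ⟨U, hU, -, hUle⟩ := K.union δ _ hδ.bot_lt h.incP
  obtain ⟨V, hV, -, hVle⟩ := K.union δ _ hδ.bot_lt h.incQ
  obtain ⟨G, hG⟩ := exists_glue (A := fun α => (σ α).P) (fun α => (σ α).g)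
    fun α β h1 h2 => (h.le α β h1 h2).g
  obtain ⟨E, hE⟩ := exists_glue (A := fun α => (σ α).P) (fun α => (σ α).e)
    fun α β h1 h2 => (h.le α β h1 h2).e
  exact ⟨⟨U, V, G, E⟩, fun α hα => ⟨hUle α hα, hVle α hα, hG α hα, hE α hα⟩, hU, hV,
    emb_union hδ h.incP h.P hU fun α hα =>
      ((hv α hα).g.mono_right (hVle α hα)).congr (hG α hα).symm,
    emb_union hδ h.incP h.P hU fun α hα => (hv α hα).e.congr (hE α hα).symm⟩

/-- Construction of chains of stages by transfinite recursion. -/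
theorem exists_chain (hlam : ℵ₀ ≤ lam) {N : Mod L} {θ : Ordinal.{u}}
    (hθ : θ ≤ (Order.succ lam).ord) (base : Stage L) (Inv : Stage L → Prop)
    (Step : Ordinal.{u} → Stage L → Stage L → Prop)
    (hbase : Valid K lam N base) (hbaseI : Inv base)
    (hstep : ∀ α, Order.succ α < θ → ∀ σ, Valid K lam N σ → Inv σ →
      ∃ τ, Valid K lam N τ ∧ Inv τ ∧ Le K σ τ ∧ Step α σ τ)
    (hlim : ∀ δ < θ, Order.IsSuccLimit δ → ∀ σ : Ordinal.{u} → Stage L, σ 0 = base →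
      (∀ α ≤ δ, Valid K lam N (σ α)) → (∀ α < δ, Inv (σ α)) → IsChain K (Order.succ δ) σ →
      Inv (σ δ)) :
    ∃ σ : Ordinal.{u} → Stage L, (0 < θ → σ 0 = base) ∧ (∀ α < θ, Valid K lam N (σ α)) ∧
      (∀ α < θ, Inv (σ α)) ∧ IsChain K θ σ ∧
      ∀ α, Order.succ α < θ → Step α (σ α) (σ (Order.succ α)) := by
  classical
  let Good : Ordinal.{u} → (Ordinal.{u} → Stage L) → Prop := fun α σ =>
    Valid K lam N (σ α) ∧ Inv (σ α) ∧ (∀ β < α, Le K (σ β) (σ α)) ∧ (α = 0 → σ α = base) ∧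
    (∀ β < α, α = Order.succ β → Step β (σ β) (σ α)) ∧
    (Order.IsSuccLimit α → IsUnion α (fun β => (σ β).P) (σ α).P ∧
      IsUnion α (fun β => (σ β).Q) (σ α).Q)
  have isUnion_congr : ∀ {α : Ordinal.{u}} {A A' : Ordinal.{u} → Mod L} {U : Mod L},
      (∀ β < α, A β = A' β) → IsUnion α A U → IsUnion α A' U := by
    intro α A A' U hAA h
    refine ⟨?_, fun β hβ => hAA β hβ ▸ h.2 β hβ⟩
    rw [h.1]
    exact Set.iUnion₂_congr fun β hβ => by rw [hAA β hβ]
  have hcongr : ∀ α σ τ, (∀ β ≤ α, σ β = τ β) → Good α σ → Good α τ := by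
    rintro α σ τ he ⟨h1, h2, h3, h4, h5, h6⟩
    have hα := he α le_rfl
    refine ⟨hα ▸ h1, hα ▸ h2, fun β hβ => ?_, fun h0 => hα ▸ h4 h0, fun β hβ hs => ?_,
      fun hl => ⟨?_, ?_⟩⟩
    · rw [← he β hβ.le, ← hα]; exact h3 β hβ
    · rw [← he β hβ.le, ← hα]; exact h5 β hβ hs
    · rw [← hα]; exact isUnion_congr (fun β hβ => by rw [he β hβ.le]) (h6 hl).1
    · rw [← hα]; exact isUnion_congr (fun β hβ => by rw [he β hβ.le]) (h6 hl).2
  have chain_of_good : ∀ {θ' : Ordinal.{u}} {σ : Ordinal.{u} → Stage L},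
      (∀ β < θ', Good β σ) → IsChain K θ' σ := by
    intro θ' σ hg
    refine ⟨fun α β hαβ hβ => ?_, fun γ hγ hl => ((hg γ hγ).2.2.2.2.2 hl).1,
      fun γ hγ hl => ((hg γ hγ).2.2.2.2.2 hl).2⟩
    obtain rfl | hlt := hαβ.eq_or_lt
    · exact (hg α hβ).1.refl
    · exact (hg β hβ).2.2.1 α hlt
  have : Nonempty (Stage L) := ⟨base⟩
  obtain ⟨σ, hσ⟩ := exists_seq θ Good hcongr <| by
    intro α hα σ hg
    have hval : ∀ β < α, ∀ x, Function.update σ α x β = σ β := fun β hβ x =>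
      Function.update_of_ne hβ.ne _ _
    obtain rfl | ⟨α, rfl⟩ | hl := Ordinal.zero_or_succ_or_isSuccLimit α
    · refine ⟨base, ?_⟩
      simp only [Good, Function.update_self]
      refine ⟨hbase, hbaseI, fun β hβ => absurd hβ not_lt_zero, fun _ => trivial,
        fun β hβ => absurd hβ not_lt_zero, fun hl => absurd hl Order.not_isSuccLimit_bot⟩
    · obtain ⟨τ, h1, h2, h3, h4⟩ := hstep α hα (σ α) (hg α (Order.lt_succ α)).1
        (hg α (Order.lt_succ α)).2.1
      refine ⟨τ, ?_⟩
      simp only [Good, Function.update_self]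
      refine ⟨h1, h2, fun β hβ => ?_, fun h0 => absurd h0 (Order.bot_lt_succ α).ne',
        fun β hβ hs => ?_, fun hl => absurd hl (Order.not_isSuccLimit_succ α)⟩
      · rw [hval β hβ]
        exact ((chain_of_good hg).le β α (Order.lt_succ_iff.1 hβ) (Order.lt_succ α)).trans h3
      · obtain rfl := Order.succ_injective hs
        rw [hval _ hβ]
        exact h4
    · have hch := chain_of_good hg
      obtain ⟨τ, hle, hP, hQ, hgE, heE⟩ := hch.exists_union hl fun β hβ => (hg β hβ).1
      have hlt := hα.trans_le hθ
      have hv : Valid K lam N τ :=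
        ⟨inCard_union hP hlam hl.bot_lt hlt (fun β hβ => (hg β hβ).1.P) hgE.mem_left,
          inCard_union hQ hlam hl.bot_lt hlt (fun β hβ => (hg β hβ).1.Q) hgE.mem_right, hgE, heE⟩
      have hP' : IsUnion α (fun β => (Function.update σ α τ β).P) τ.P :=
        isUnion_congr (fun β hβ => by rw [hval β hβ]) hP
      have hQ' : IsUnion α (fun β => (Function.update σ α τ β).Q) τ.Q :=
        isUnion_congr (fun β hβ => by rw [hval β hβ]) hQ
      have hg' : ∀ β < α, Good β (Function.update σ α τ) := fun β hβ =>
        hcongr β σ _ (fun γ hγ => (hval γ (hγ.trans_lt hβ) τ).symm) (hg β hβ)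
      refine ⟨τ, ?_⟩
      -- The limit invariant may depend on the whole chain with its union on top, so the chain is
      -- closed off by `τ` before `hlim` is invoked.
      have hch' : IsChain K (Order.succ α) (Function.update σ α τ) := by
        have hc := chain_of_good hg'
        refine ⟨fun β γ hβγ hγ => ?_, fun γ hγ hlγ => ?_, fun γ hγ hlγ => ?_⟩
        · obtain rfl | hγ' := (Order.lt_succ_iff.1 hγ).eq_or_lt
          · obtain rfl | hβ := hβγ.eq_or_lt
            · rw [Function.update_self]; exact hv.refl
            · rw [Function.update_self, hval β hβ]; exact hle β hβ
          · exact hc.le β γ hβγ hγ'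
        · obtain rfl | hγ' := (Order.lt_succ_iff.1 hγ).eq_or_lt
          · simpa only [Function.update_self] using hP'
          · exact hc.P γ hγ' hlγ
        · obtain rfl | hγ' := (Order.lt_succ_iff.1 hγ).eq_or_lt
          · simpa only [Function.update_self] using hQ'
          · exact hc.Q γ hγ' hlγ
      have hI := hlim α hα hl (Function.update σ α τ) ((hg' 0 hl.bot_lt).2.2.2.1 rfl)
        (fun β hβ => by
          obtain rfl | hβ := hβ.eq_or_lt
          · rw [Function.update_self]; exact hv
          · exact (hg' β hβ).1) (fun β hβ => (hg' β hβ).2.1) hch'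
      rw [Function.update_self] at hI
      refine ⟨by rwa [Function.update_self], by rwa [Function.update_self], fun β hβ => ?_,
        fun h0 => absurd h0 hl.bot_lt.ne', fun β _ hs => ?_, fun _ => ?_⟩
      · rw [Function.update_self, hval β hβ]; exact hle β hβ
      · rw [hs] at hl
        exact absurd hl (Order.not_isSuccLimit_succ β)
      · rw [Function.update_self]; exact ⟨hP', hQ'⟩
  exact ⟨σ, fun h0 => (hσ 0 h0).2.2.2.1 rfl, fun α hα => (hσ α hα).1, fun α hα => (hσ α hα).2.1,
    chain_of_good hσ, fun α hα => (hσ _ hα).2.2.2.2.1 α (Order.lt_succ α) rfl⟩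

end Stage

end AEC

/-- Only covering is claimed: values outside `X` can occur, so users of the enumeration guard it by
a membership test. -/
theorem exists_enumeration {κ : Cardinal.{u}} {X : Set ZFSet.{u}}
    (hX : #X ≤ Cardinal.lift.{u + 1} κ) :
    ∃ c : Ordinal.{u} → ZFSet.{u}, X ⊆ c '' Set.Iio κ.ord := by
  classical
  have : #X ≤ #(Set.Iio κ.ord) := by rwa [Cardinal.mk_Iio_ordinal, Cardinal.card_ord]
  obtain ⟨i⟩ := this
  refine ⟨Function.extend (fun x : X => (i x : Ordinal.{u})) (fun x => x) fun _ => ∅, fun x hx =>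
    ⟨i ⟨x, hx⟩, (i ⟨x, hx⟩).2, ?_⟩⟩
  exact (Subtype.val_injective.comp i.injective).extend_apply (fun x : X => (x : ZFSet.{u})) _
    ⟨x, hx⟩

/-! ### Saturated models are model-homogeneous -/

namespace AEC

variable {K : AEC L} {lam : Cardinal.{u}}

theorem InCard.mk_insert_le (hlam : ℵ₀ ≤ lam) {A : Mod L} (hA : K.InCard lam A)
    (F : ZFSet.{u} → ZFSet.{u}) (a : ZFSet.{u}) :
    #(F '' A.carrier ∪ {a} : Set ZFSet.{u}) ≤ Cardinal.lift.{u + 1} lam := by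
  have hinf : ℵ₀ ≤ Cardinal.lift.{u + 1} lam := Cardinal.aleph0_le_lift.2 hlam
  refine (Cardinal.mk_union_le _ _).trans (Cardinal.add_le_of_le hinf
    (Cardinal.mk_image_le.trans hA.2.le) ?_)
  rw [Cardinal.mk_singleton]
  exact Cardinal.one_le_aleph0.trans hinf

theorem le_of_subset {A B C : Mod L} (hA : K.le A C) (hB : K.le B C)
    (h : A.carrier ⊆ B.carrier) : K.le A B :=
  K.coherence ((K.isSub hA).of_subset (K.isSub hB) h) (K.isSub hB) hA hB

/-- A given extension of a small strong submodel of a saturated model embeds over it. -/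
theorem IsSaturated.exists_emb_of_le (hlam : ℵ₀ ≤ lam) (hlst : K.LST ≤ lam)
    (hamalg : K.HasAmalgamation lam) {N A C : Mod L} (hN : K.IsSaturated lam N) (hAN : K.le A N)
    (hAC : K.le A C) (hA : K.InCard lam A) (hC : K.InCard lam C) :
    ∃ e, K.Emb e C N ∧ Set.EqOn e id A.carrier := by
  obtain ⟨c, hc⟩ := exists_enumeration hC.2.le
  have hNle : Cardinal.lift.{u + 1} lam ≤ #N := by
    rw [hN.1.2]; exact Cardinal.lift_le.2 (Order.le_succ lam)
  have hne : ∀ P, K.InCard lam P → P ≠ N := by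
    rintro P hP rfl
    exact (Order.lt_succ lam).ne (Cardinal.lift_injective (hP.2.symm.trans hN.1.2))
  -- In `λ` steps, `P` grows inside `N` from `A` while `Q` grows from `C`, with `g` embedding `P`
  -- into `Q`. Step `i` brings the `i`-th point of `C` into the range of `g`. In the end `C` lies in
  -- the range, and the inverse of `g` embeds `C` into `N`.
  obtain ⟨σ, h0, hv, hI, hch, hst⟩ := Stage.exists_chain (K := K) (θ := lam.ord) hlam
    (Cardinal.ord_le_ord.2 (Order.le_succ lam)) ⟨A, C, id, id⟩
    (fun σ => Set.EqOn σ.e id σ.P.carrier)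
    (fun i σ τ => c i ∈ σ.Q.carrier → c i ∈ τ.g '' τ.P.carrier)
    ⟨hA, hC, emb_id hAC, emb_id hAN⟩ (fun _ _ => rfl)
    (by
      intro i _ σ hv hI
      by_cases hi : c i ∈ σ.Q.carrier
      swap
      · exact ⟨σ, hv, hI, hv.refl, fun h => absurd h hi⟩
      have hPN : K.le σ.P N := hv.e.le_of_id hI
      -- Once `g` is turned into an inclusion, the type of `c i` over `P` is realized in `N` by some
      -- `a`. A small `P'` containing `P` and `a` is amalgamated with `Q'` so that `a` goes to `c
      -- i`; the last renaming restores `Q` as a literal submodel.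
      obtain ⟨Q', G, hPQ', hG, hQ'c, hGg⟩ := hv.g.exists_rename'
      obtain ⟨a, ha, hta⟩ := hN.2 σ.P hPN hv.P (hne _ hv.P) (tp hPQ' (G (c i)) (hG.mapsTo hi))
      obtain ⟨P', hP'N, hZ, hP'⟩ := exists_le_inCard hlst hN.1.1 hNle
        (Z := id '' σ.P.carrier ∪ {a})
        (Set.union_subset (by rw [Set.image_id]; exact (K.isSub hPN).subset)
          (Set.singleton_subset_iff.2 ha)) (hv.P.mk_insert_le hlam id a)
      rw [Set.image_id] at hZ
      have haP' : a ∈ P'.carrier := hZ (Or.inr rfl)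
      have hPP' : K.le σ.P P' := le_of_subset hPN hP'N (Set.subset_union_left.trans hZ)
      obtain ⟨D, H, hD, hQ'D, hH, hHid, hHa⟩ := exists_emb_of_tp_eq hlst hamalg hv.P
        (hv.Q.of_emb hG hQ'c) hP' (hta.trans (tp_eq_of_le hPP' hP'N haP').symm)
      obtain ⟨D', J, hQD', hJ, hD'c, hJG⟩ := (hG.mono_right hQ'D).exists_rename'
      refine ⟨⟨P', D', J ∘ H, id⟩, ⟨hP', hD.of_emb hJ hD'c, hJ.comp hH, emb_id hP'N⟩,
        fun _ _ => rfl, ⟨hPP', hQD', fun x hx => ?_, fun x hx => (hI hx).symm⟩,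
        fun _ => ⟨a, haP', ?_⟩⟩
      · have h1 : H x = x := hHid hx
        have h2 : G (σ.g x) = x := hGg hx
        have h3 : J (G (σ.g x)) = σ.g x := hJG (hv.g.mapsTo hx)
        change J (H x) = σ.g x
        rw [h1]
        nth_rw 1 [← h2]
        exact h3
      · change J (H a) = c i
        rw [hHa]
        exact hJG hi)
    (by
      intro δ _ hl σ _ _ hI hch x hx
      obtain ⟨α, hα, hx'⟩ := (hch.P δ (Order.lt_succ δ) hl).mem_iff.1 hx
      exact ((hch.le α δ hα.le (Order.lt_succ δ)).e hx').trans (hI α hα hx'))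
  have hl : Order.IsSuccLimit lam.ord := Cardinal.isSuccLimit_ord hlam
  have h0 := h0 hl.bot_lt
  obtain ⟨τ, hle, hP, hQ, hg, he⟩ := hch.exists_union hl hv
  have hle0 := hle 0 hl.bot_lt
  rw [h0] at hle0
  have hCI : C.carrier ⊆ τ.g '' τ.P.carrier := by
    intro y hy
    obtain ⟨i, hi, rfl⟩ := hc hy
    have hs : Order.succ i < lam.ord := hl.succ_lt hi
    have hyi : c i ∈ (σ i).Q.carrier := by
      have := (hch.le 0 i zero_le hi).Q
      rw [h0] at this
      exact (K.isSub this).subset hy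
    obtain ⟨z, hz, hzc⟩ := hst i hs hyi
    exact ⟨z, (K.isSub (hle _ hs).P).subset hz, ((hle _ hs).g hz).trans hzc⟩
  obtain ⟨I, hIQ, hIc, hgI⟩ := hg.exists_image
  have hinv : Set.LeftInvOn (Function.invFunOn τ.g τ.P.carrier) τ.g τ.P.carrier :=
    hg.injOn.leftInvOn_invFunOn
  have hCI' : K.le C I := le_of_subset hle0.Q hIQ (by rwa [hIc])
  refine ⟨_, he.comp ((hgI.inverse (by rw [hIc]; exact Set.surjOn_image _ _) hinv).mono_left hCI'),
    fun x hx => ?_⟩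
  have h1 : τ.g x = x := hle0.g hx
  have h2 := hinv ((K.isSub hle0.P).subset hx)
  rw [h1] at h2
  rw [Function.comp_apply, h2]
  exact hle0.e hx

/-- Saturated models are model-homogeneous. -/
theorem IsSaturated.exists_extension (hlam : ℵ₀ ≤ lam) (hlst : K.LST ≤ lam)
    (hamalg : K.HasAmalgamation lam) {N A C : Mod L} (hN : K.IsSaturated lam N)
    (hAC : K.le A C) (hA : K.InCard lam A) (hC : K.InCard lam C) {e : ZFSet.{u} → ZFSet.{u}}
    (he : K.Emb e A N) : ∃ e', K.Emb e' C N ∧ Set.EqOn e' e A.carrier := by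
  obtain ⟨A', hA'N, hA'c, heA⟩ := he.exists_image
  have hinv : Set.LeftInvOn (Function.invFunOn e A.carrier) e A.carrier :=
    he.injOn.leftInvOn_invFunOn
  have hback := heA.inverse (by rw [hA'c]; exact Set.surjOn_image _ _) hinv
  -- Replacing `C` by a copy over `e[A]` reduces to the case of an inclusion.
  obtain ⟨C', G, hA'C', hG, hC'c, hGid⟩ := (hback.mono_right hAC).exists_rename'
  obtain ⟨k, hk, hkid⟩ := hN.exists_emb_of_le hlam hlst hamalg hA'N hA'C' (hA.of_emb heA hA'c)
    (hC.of_emb hG hC'c)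
  refine ⟨k ∘ G, hk.comp hG, fun x hx => ?_⟩
  have h1 : G (Function.invFunOn e A.carrier (e x)) = e x := hGid (heA.mapsTo hx)
  rw [hinv hx] at h1
  rw [Function.comp_apply, h1]
  exact hkid (heA.mapsTo hx)

/-- Saturation is preserved by isomorphisms. -/
theorem IsSaturated.of_surjOn (hlam : ℵ₀ ≤ lam) (hlst : K.LST ≤ lam)
    (hamalg : K.HasAmalgamation lam) {N N₀ : Mod L} (hN : K.IsSaturated lam N₀)
    {e : ZFSet.{u} → ZFSet.{u}} (he : K.Emb e N N₀) (hs : Set.SurjOn e N.carrier N₀.carrier) :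
    K.IsSaturated lam N := by
  have hinv : Set.LeftInvOn (Function.invFunOn e N.carrier) e N.carrier :=
    he.injOn.leftInvOn_invFunOn
  have hback := he.inverse hs hinv
  refine ⟨hN.1.of_emb hback ?_, fun M hMN hM _ p => ?_⟩
  · refine subset_antisymm (fun x hx => ⟨e x, he.mapsTo hx, hinv hx⟩) hback.mapsTo.image_subset
  · obtain ⟨⟨E, hME, c, hc⟩, rfl⟩ := Quot.exists_rep p
    obtain ⟨E₀, hE₀E, hZ, hE₀⟩ := exists_le_inCard hlst (K.mem_right hME) (hM.mk_le (emb_id hME))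
      (Z := id '' M.carrier ∪ {c})
      (Set.union_subset (by rw [Set.image_id]; exact (K.isSub hME).subset)
        (Set.singleton_subset_iff.2 hc)) (hM.mk_insert_le hlam id c)
    rw [Set.image_id] at hZ
    have hME₀ : K.le M E₀ := le_of_subset hME hE₀E (Set.subset_union_left.trans hZ)
    have hcE₀ : c ∈ E₀.carrier := hZ (Or.inr rfl)
    -- Homogeneity of `N₀` extends `e` from `M` to a small model realizing the type; pulling back
    -- along the inverse of `e` realizes it in `N`.
    obtain ⟨k, hk, hke⟩ := hN.exists_extension hlam hlst hamalg hME₀ hM hE₀ (he.mono_left hMN)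
    refine ⟨_, (hback.comp hk).mapsTo hcE₀, ?_⟩
    rw [← tp_eq_of_emb hME₀ hMN (hback.comp hk) ?_ hcE₀ _ rfl]
    · exact (tp_eq_of_le hME₀ hE₀E hcE₀).symm
    · intro x hx
      rw [Function.comp_apply, hke hx]
      exact hinv ((K.isSub hMN).subset hx)

end AEC

/-! ### Clubs and guessing -/

/-- Regularity of `λ⁺`, stated for index types one universe up because carriers of models live
there. -/
theorem exists_bound {lam : Cardinal.{u}} (hlam : ℵ₀ ≤ lam) {ι : Type (u + 1)}
    (hι : #ι ≤ Cardinal.lift.{u + 1} lam) (f : ι → Ordinal.{u})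
    (hf : ∀ i, f i < (Order.succ lam).ord) : ∃ β < (Order.succ lam).ord, ∀ i, f i < β := by
  have : Small.{u} ι := by
    rw [Cardinal.small_iff_lift_mk_lt_univ]
    simpa using hι.trans_lt (Cardinal.lift_lt_univ' lam)
  refine ⟨⨆ i, f i + 1, Ordinal.lift_iSup_add_one_lt_of_lt_cof ?_ hf, Ordinal.lt_iSup_add_one f⟩
  rw [Cardinal.lift_ord, Cardinal.lift_succ, (Cardinal.isRegular_succ
    (Cardinal.aleph0_le_lift.2 hlam)).cof_ord, Cardinal.lift_id'.{u, u + 1}]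
  exact Order.lt_succ_iff.2 hι

/-- Limits are required in addition to closure so that, at such `α`, a continuous chain is the union
of its earlier members. -/
theorem isClub_closurePoints {lam : Cardinal.{u}} (hlam : ℵ₀ ≤ lam) (f : Ordinal.{u} → Ordinal.{u})
    (hf : ∀ β < (Order.succ lam).ord, f β < (Order.succ lam).ord) :
    IsClub {α : Set.Iio (Order.succ lam).ord | Order.IsSuccLimit (α : Ordinal.{u}) ∧
      ∀ β < (α : Ordinal.{u}), f β ≤ α} := by
  have hlim : Order.IsSuccLimit (Order.succ lam).ord :=
    Cardinal.isSuccLimit_ord (hlam.trans (Order.le_succ lam))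
  refine ⟨fun d hd hne _ a ha => ?_, fun a => ?_⟩
  · have key : ∀ c < (a : Ordinal.{u}), ∃ b ∈ d, c < (b : Ordinal.{u}) := by
      intro c hc
      by_contra! h
      exact absurd (ha.2 (show (⟨c, hc.trans a.2⟩ : Set.Iio (Order.succ lam).ord) ∈ upperBounds d
        from fun b hb => h b hb)) (not_le_of_gt (show (⟨c, hc.trans a.2⟩ :
          Set.Iio (Order.succ lam).ord) < a from hc))
    refine ⟨⟨?_, Order.isSuccPrelimit_of_succ_lt fun c hc => ?_⟩, fun β hβ => ?_⟩
    · obtain ⟨b, hb⟩ := hne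
      rw [isMin_iff_eq_bot]
      exact ((hd hb).1.bot_lt.trans_le (ha.1 hb)).ne'
    · obtain ⟨b, hb, hcb⟩ := key c hc
      exact ((hd hb).1.succ_lt hcb).trans_le (ha.1 hb)
    · obtain ⟨b, hb, hcb⟩ := key β hβ
      exact ((hd hb).2 β hcb).trans (ha.1 hb)
  · have hstep : ∀ γ : Set.Iio (Order.succ lam).ord, ∃ γ' : Set.Iio (Order.succ lam).ord,
        γ < γ' ∧ ∀ β < (γ : Ordinal.{u}), f β ≤ γ' := by
      intro γ
      obtain ⟨b, hb, hfb⟩ := exists_bound hlam (ι := Set.Iio (γ : Ordinal.{u})) (by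
        rw [Cardinal.mk_Iio_ordinal]
        exact Cardinal.lift_le.2 (Order.lt_succ_iff.1 (Cardinal.lt_ord.1 γ.2)))
        (fun β => f β) fun β => hf β (lt_trans β.2 γ.2)
      refine ⟨⟨max (Order.succ γ) b, max_lt (hlim.succ_lt γ.2) hb⟩, ?_, fun β hβ => ?_⟩
      · exact (Order.lt_succ (γ : Ordinal.{u})).trans_le (le_max_left _ _)
      · exact (hfb ⟨β, hβ⟩).le.trans (le_max_right _ _)
    choose g hg hgf using hstep
    -- The supremum of `ω` iterations of the closure step is a closure point above `a`; regularity
    -- keeps it below `λ⁺`.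
    let c : ℕ → Set.Iio (Order.succ lam).ord := fun n => g^[n] a
    have hc : ∀ n, c (n + 1) = g (c n) := fun n => Function.iterate_succ_apply' g n a
    obtain ⟨b, hb, hcb⟩ := exists_bound hlam (ι := ULift.{u + 1} ℕ) (by simpa using hlam)
      (fun n => (c n.down : Ordinal.{u})) fun n => (c n.down).2
    have hbdd : BddAbove (Set.range fun n => (c n : Ordinal.{u})) :=
      ⟨b, by rintro _ ⟨n, rfl⟩; exact (hcb ⟨n⟩).le⟩
    have hle : ∀ n, (c n : Ordinal.{u}) ≤ ⨆ n, (c n : Ordinal.{u}) := le_ciSup hbdd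
    have hlt : ∀ β < ⨆ n, (c n : Ordinal.{u}), ∃ n, β < (c n : Ordinal.{u}) := fun β hβ =>
      exists_lt_of_lt_ciSup hβ
    have hsup : ⨆ n, (c n : Ordinal.{u}) < (Order.succ lam).ord :=
      (ciSup_le fun n => (hcb ⟨n⟩).le).trans_lt hb
    refine ⟨⟨_, hsup⟩, ⟨⟨?_, Order.isSuccPrelimit_of_succ_lt fun β hβ => ?_⟩, fun β hβ => ?_⟩,
      hle 0⟩
    · rw [isMin_iff_eq_bot]
      have h1 : (c 0 : Ordinal.{u}) < c 1 := by rw [hc 0]; exact hg _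
      exact ((bot_le.trans_lt h1).trans_le (hle 1)).ne'
    · obtain ⟨n, hn⟩ := hlt β hβ
      have h1 : (c n : Ordinal.{u}) < c (n + 1) := by rw [hc n]; exact hg _
      exact ((Order.succ_le_of_lt hn).trans_lt h1).trans_le (hle (n + 1))
    · obtain ⟨n, hn⟩ := hlt β hβ
      have h1 : f β ≤ c (n + 1) := by rw [hc n]; exact hgf _ β hn
      exact h1.trans (hle (n + 1))

/-- Uncountable cofinality is what lets two clubs be intersected. -/
theorem cof_Iio_succ_ord_ne {lam : Cardinal.{u}} (hlam : ℵ₀ ≤ lam) :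
    Order.cof (Set.Iio (Order.succ lam).ord) ≠ ℵ₀ := by
  rw [Ordinal.cof_Iio, Cardinal.lift_ord, Cardinal.lift_succ, (Cardinal.isRegular_succ
    (Cardinal.aleph0_le_lift.2 hlam)).cof_ord]
  exact (Order.lt_succ_of_le (Cardinal.aleph0_le_lift.2 hlam)).ne'

/-- Turns the graph of a map from `U` to `V` into a set of ordinals below `κ`, the kind of object a
diamond sequence guesses. -/
theorem exists_code {κ : Cardinal.{u}} (hκ : ℵ₀ ≤ κ) {U V : Set ZFSet.{u}}
    (hU : #U ≤ Cardinal.lift.{u + 1} κ) (hV : #V ≤ Cardinal.lift.{u + 1} κ) :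
    ∃ code : ZFSet.{u} → ZFSet.{u} → Ordinal.{u}, (∀ x ∈ U, ∀ y ∈ V, code x y < κ.ord) ∧
      ∀ x ∈ U, ∀ y ∈ V, ∀ x' ∈ U, ∀ y' ∈ V, code x y = code x' y' → x = x' ∧ y = y' := by
  classical
  have : #(U × V) ≤ #(Set.Iio κ.ord) := by
    rw [Cardinal.mk_Iio_ordinal, Cardinal.card_ord, Cardinal.mk_prod, Cardinal.lift_id,
      Cardinal.lift_id]
    exact Cardinal.mul_le_of_le (Cardinal.aleph0_le_lift.2 hκ) hU hV
  obtain ⟨i⟩ := this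
  let code : ZFSet.{u} → ZFSet.{u} → Ordinal.{u} := fun x y =>
    if h : x ∈ U ∧ y ∈ V then (i (⟨x, h.1⟩, ⟨y, h.2⟩) : Ordinal.{u}) else 0
  have hcode : ∀ x (hx : x ∈ U) y (hy : y ∈ V), code x y = i (⟨x, hx⟩, ⟨y, hy⟩) :=
    fun x hx y hy => dif_pos ⟨hx, hy⟩
  refine ⟨code, fun x hx y hy => ?_, fun x hx y hy x' hx' y' hy' h => ?_⟩
  · rw [hcode x hx y hy]
    exact (i _).2
  · rw [hcode x hx y hy, hcode x' hx' y' hy'] at h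
    have := i.injective (Subtype.ext h)
    simpa using this

/-! ### Extending basic triples -/

namespace PreFrame

variable {K : AEC L} {lam : Cardinal.{u}} {s : PreFrame K lam}

open AEC

/-- If `(A, B, b)` is not a uniqueness triple, then a given pair of embeddings of `A` and of `B`
can be prevented from having a common extension. -/
theorem exists_not_extendable (hamalg : K.HasAmalgamation lam) {A B N₀ N₁ : Mod L} {b : ZFSet.{u}}
    (hbasic : s.IsBasicTriple A B b) (hnu : ¬ s.IsUniquenessTriple A B b)
    (hN₀ : K.IsSaturated lam N₀) {e : ZFSet.{u} → ZFSet.{u}}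
    (he : K.Emb e A N₀) (k : ZFSet.{u} → ZFSet.{u}) {U : Set ZFSet.{u}} (hBU : B.carrier ⊆ U)
    (hU : Cardinal.lift.{u + 1} lam ≤ #(U \ B.carrier : Set ZFSet.{u})) :
    ∃ (C D : Mod L) (e' : ZFSet.{u} → ZFSet.{u}) (hCD : K.le C D) (hb : b ∈ D.carrier),
      K.InCard lam D ∧ K.le A C ∧ K.le B D ∧ D.carrier ⊆ U ∧ s.DNF (tp hCD b hb) A ∧
      K.Emb e' C N₀ ∧ Set.EqOn e' e A.carrier ∧
      ¬ ∃ h, K.Emb h D N₁ ∧ Set.EqOn h k B.carrier ∧ Set.EqOn h e' C.carrier := by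
  obtain ⟨C, hC, -, hAB, hb, hAC, D, F, hCD, hCF, fD, fF, hD, hF, haD, haF, hne, htp, hdnf⟩ :
      ∃ C, s.WitnessesNonuniqueness C A B b := by
    by_contra h
    exact hnu ⟨hbasic, h⟩
  have hA := hbasic.1
  -- The extension of `e` to `C` is fixed before an amalgam is selected, so both candidates are
  -- tested against the same map.
  obtain ⟨e₀, he₀, he₀e⟩ := hN₀.exists_extension s.aleph0_le s.lst_le hamalg hAC hA hC he
  have key : ∃ (X : Mod L) (f : ZFSet.{u} → ZFSet.{u}) (hCX : K.le C X) (hbX : f b ∈ X.carrier),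
      K.InCard lam X ∧ K.Emb f B X ∧ Set.EqOn f id A.carrier ∧ s.DNF (tp hCX (f b) hbX) A ∧
      ¬ ∃ h, K.Emb h X N₁ ∧ Set.EqOn (h ∘ f) k B.carrier ∧ Set.EqOn h e₀ C.carrier := by
    have conv : ∀ (X : Mod L) (hCX : K.le C X) (fX : B ↪[L] X),
        K.IsAmalgamation (Mod.incl (K.isSub hAB)) (Mod.incl (K.isSub hAC)) fX
          (Mod.incl (K.isSub hCX)) →
        ∃ f, K.Emb f B X ∧ (∀ x, (fX x : ZFSet.{u}) = f x) ∧ Set.EqOn f id A.carrier := by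
      rintro X hCX fX ⟨-, -, hfX, -, hcomm⟩
      obtain ⟨f, hf, hfv⟩ := hfX.exists_emb
      refine ⟨f, hf, hfv, fun a ha => ?_⟩
      exact (hfv (Mod.incl (K.isSub hAB) ⟨a, ha⟩)).symm.trans
        (congrArg Subtype.val (DFunLike.congr_fun hcomm ⟨a, ha⟩))
    obtain ⟨f₁, hf₁, hfv₁, hid₁⟩ := conv D hCD fD haD
    obtain ⟨f₂, hf₂, hfv₂, hid₂⟩ := conv F hCF fF haF
    have ht1 : tp hCD (fD ⟨b, hb⟩ : D) (fD ⟨b, hb⟩).2 = tp hCD (f₁ b) (hf₁.mapsTo hb) :=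
      tp_eq_of_emb hCD hCD (emb_id (K.refl hD.1)) (fun _ _ => rfl) _ _ (hfv₁ ⟨b, hb⟩)
    have ht2 : tp hCF (fF ⟨b, hb⟩ : F) (fF ⟨b, hb⟩).2 = tp hCF (f₂ b) (hf₂.mapsTo hb) :=
      tp_eq_of_emb hCF hCF (emb_id (K.refl hF.1)) (fun _ _ => rfl) _ _ (hfv₂ ⟨b, hb⟩)
    -- If both amalgams had an embedding into `N₁` given by `k` on `B` and by `e₀` on `C`, then `N₁`
    -- would witness their equivalence.
    by_contra! hcon
    obtain ⟨h₁, hh₁, hk₁, hc₁⟩ := hcon D f₁ hCD (hf₁.mapsTo hb) hD hf₁ hid₁ (ht1 ▸ hdnf)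
    obtain ⟨h₂, hh₂, hk₂, hc₂⟩ := hcon F f₂ hCF (hf₂.mapsTo hb) hF hf₂ hid₂ (ht2 ▸ htp ▸ hdnf)
    obtain ⟨m₁, hm₁, hmv₁⟩ := hh₁
    obtain ⟨m₂, hm₂, hmv₂⟩ := hh₂
    refine hne ⟨N₁, m₁, m₂, hm₁, hm₂, ?_, ?_⟩
    · refine FirstOrder.Language.Embedding.ext fun x => Subtype.ext ?_
      change (m₁ (fD x) : ZFSet.{u}) = m₂ (fF x)
      rw [hmv₁, hmv₂, hfv₁, hfv₂]
      exact (hk₁ x.2).trans (hk₂ x.2).symm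
    · refine FirstOrder.Language.Embedding.ext fun x => Subtype.ext ?_
      change (m₁ (Mod.incl _ x) : ZFSet.{u}) = m₂ (Mod.incl _ x)
      rw [hmv₁, hmv₂]
      exact (hc₁ x.2).trans (hc₂ x.2).symm
  obtain ⟨X, f, hCX, hbX, hX, hf, hid, hdnf', hno⟩ := key
  -- The next renaming makes `B` a literal submodel but moves `C`, hence the domain of the type.
  -- Enlarging `X` until `nf` holds of the point itself lets non-forking be transported by `nf_emb`.
  obtain ⟨G, hG, hXG, hnf⟩ := hdnf'.exists_nf hamalg hX
  obtain ⟨G', J, hBG', hG'U, hJ, hG'c, hJf⟩ := (hf.mono_right hXG).exists_rename hBU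
    (by rw [hG.2]; exact hU)
  have hG' := hG.of_emb hJ hG'c
  have hJX := hJ.mono_left (K.trans hCX hXG)
  obtain ⟨C', hC'G', hC'c, hJC⟩ := hJX.exists_image
  have hinv : Set.LeftInvOn (Function.invFunOn J C.carrier) J C.carrier :=
    hJX.injOn.leftInvOn_invFunOn
  have hJb : J (f b) = b := hJf hb
  have hJA : Set.EqOn J id A.carrier := by
    intro x hx
    have h1 : f x = x := hid hx
    have h2 : J (f x) = x := hJf ((K.isSub hAB).subset hx)
    rwa [h1] at h2
  have hnf' := nf_emb hnf hJ hG' (K.isSub (K.trans hAB hBG')) (by rw [hJA.image_eq, Set.image_id])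
    (K.isSub hC'G') hC'c
  rw [hJb] at hnf'
  have hbG' : b ∈ G'.carrier := (K.isSub hBG').subset hb
  refine ⟨C', G', e₀ ∘ Function.invFunOn J C.carrier, hC'G', hbG', hG', ?_, hBG', hG'U,
    dnf_of_nf hnf' _ _, he₀.comp (hJC.inverse (by rw [hC'c]; exact Set.surjOn_image _ _) hinv),
    fun x hx => ?_, ?_⟩
  · exact (s.nf_dom hnf').2.2.2.1
  · have h1 : J x = x := hJA hx
    have h2 := hinv ((K.isSub hAC).subset hx)
    rw [h1] at h2
    rw [Function.comp_apply, h2]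
    exact he₀e hx
  · rintro ⟨h, hh, hk, hc⟩
    refine hno ⟨h ∘ J, (hh.comp hJ).mono_left hXG, fun x hx => ?_, fun x hx => ?_⟩
    · have h1 : J (f x) = x := hJf hx
      change h (J (f x)) = k x
      rw [h1]
      exact hk hx
    · have hJx : J x ∈ C'.carrier := hJC.mapsTo hx
      refine (hc hJx).trans ?_
      rw [Function.comp_apply, hinv hx]

/-- A non-forking extension of a basic triple, whose first model is large enough for a given
embedding into a larger model to reach a given point. -/
theorem exists_extension_mem (hamalg : K.HasAmalgamation lam) (hext : s.Extension)
    {C D N₀ : Mod L} {b : ZFSet.{u}} {hCD : K.le C D} {hb : b ∈ D.carrier} (hC : K.InCard lam C)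
    (hD : K.InCard lam D) (hbs : tp hCD b hb ∈ s.bs C) {e : ZFSet.{u} → ZFSet.{u}}
    (he : K.Emb e C N₀) {x : ZFSet.{u}} (hx : x ∈ N₀.carrier) {U : Set ZFSet.{u}}
    (hDU : D.carrier ⊆ U)
    (hU : Cardinal.lift.{u + 1} lam ≤ #(U \ D.carrier : Set ZFSet.{u})) :
    ∃ (P Q : Mod L) (e' : ZFSet.{u} → ZFSet.{u}) (hPQ : K.le P Q) (hb : b ∈ Q.carrier),
      K.InCard lam P ∧ K.InCard lam Q ∧ K.le C P ∧ K.le D Q ∧ Q.carrier ⊆ U ∧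
      s.DNF (tp hPQ b hb) C ∧ K.Emb e' P N₀ ∧ Set.EqOn e' e C.carrier ∧ x ∈ e' '' P.carrier := by
  obtain ⟨M₀, hM₀N, hZ, hM₀⟩ := exists_le_inCard s.lst_le he.mem_right (hC.mk_le he)
    (Set.union_subset he.mapsTo.image_subset (Set.singleton_subset_iff.2 hx))
    (hC.mk_insert_le s.aleph0_le e x)
  have heM : K.Emb e C M₀ := (emb_id hM₀N).of_comp he fun z hz => hZ (Or.inl ⟨z, hz, rfl⟩)
  -- `M` is a copy of `M₀` over `C`, with `e` turned into an inclusion. The type of `b` has a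
  -- non-forking extension to `M`, and a realization of it is then identified with `b` in an amalgam
  -- with `D`.
  obtain ⟨M, ψ, hCM, hψ, hMc, hψe⟩ := heM.exists_rename'
  have hM := hM₀.of_emb hψ hMc
  obtain ⟨q, -, hq, hqd⟩ := hext C M hCM hC hM _ hbs
  obtain ⟨E, hME, c, hc, rfl, hnf⟩ := hqd
  have hE := (s.nf_dom hnf).2.2.1
  obtain ⟨G, F, hG, hDG, hF, hFid, hFc⟩ :=
    exists_emb_of_tp_eq s.lst_le hamalg hC hD hE (hAC := K.trans hCM hME) (hc := hc) hq.symm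
  obtain ⟨Q, H, hDQ, hQU, hH, hQc, hHid⟩ := (emb_id hDG).exists_rename hDU
    (by rw [hG.2]; exact hU)
  have hQ := hG.of_emb hH hQc
  have hHF := hH.comp hF
  have hHFid : Set.EqOn (H ∘ F) id C.carrier := fun y hy => by
    rw [Function.comp_apply, hFid hy]
    exact hHid ((K.isSub hCD).subset hy)
  have hHFc : (H ∘ F) c = b := by
    rw [Function.comp_apply, hFc]
    exact hHid hb
  -- `P` is the copy of `M`, and so of `M₀`, inside `Q`. The inverse of the isomorphism from `M₀` is
  -- the desired embedding, with `x` in its range.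
  obtain ⟨P, hPQ, hPc, hMP⟩ := (hHF.mono_left hME).exists_image
  have hnf' := nf_emb hnf hHF hQ (K.isSub (K.trans hCD hDQ))
    (by rw [hHFid.image_eq, Set.image_id]) (K.isSub hPQ) hPc
  rw [hHFc] at hnf'
  have hP := (s.nf_dom hnf').2.1
  have hT : K.Emb ((H ∘ F) ∘ ψ) M₀ P := hMP.comp hψ
  have hinv : Set.LeftInvOn (Function.invFunOn ((H ∘ F) ∘ ψ) M₀.carrier) ((H ∘ F) ∘ ψ)
      M₀.carrier := hT.injOn.leftInvOn_invFunOn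
  have hback := hT.inverse (by
    rw [hPc, hMc, ← Set.image_comp]; exact Set.surjOn_image _ _) hinv
  have hxM : x ∈ M₀.carrier := hZ (Or.inr rfl)
  refine ⟨P, Q, _, hPQ, (K.isSub hDQ).subset hb, hP, hQ, (s.nf_dom hnf').2.2.2.1, hDQ, hQU,
    dnf_of_nf hnf' _ _, hback.mono_right hM₀N, fun y hy => ?_, ?_⟩
  · have h1 : ψ (e y) = y := hψe hy
    have h2 := hinv (heM.mapsTo hy)
    have h3 : ((H ∘ F) ∘ ψ) (e y) = y := by
      rw [Function.comp_apply, h1]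
      exact hHFid hy
    rwa [h3] at h2
  · exact ⟨_, hT.mapsTo hxM, hinv hxM⟩

end PreFrame

theorem lift_le_mk_sdiff {lam : Cardinal.{u}} (hlam : ℵ₀ ≤ lam) {U X : Set ZFSet.{u}}
    (hU : Cardinal.lift.{u + 1} (Order.succ lam) ≤ #U) (hX : #X ≤ Cardinal.lift.{u + 1} lam) :
    Cardinal.lift.{u + 1} lam ≤ #(U \ X : Set ZFSet.{u}) := by
  by_contra! h
  have h1 : #U ≤ Cardinal.lift.{u + 1} lam :=
    (Cardinal.mk_le_mk_of_subset (Set.sdiff_union_self.symm ▸ Set.subset_union_left :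
      U ⊆ U \ X ∪ X)).trans ((Cardinal.mk_union_le _ _).trans
      (Cardinal.add_le_of_le (Cardinal.aleph0_le_lift.2 hlam) h.le hX))
  exact absurd (Cardinal.lift_le.1 (hU.trans h1)) (not_le_of_gt (Order.lt_succ lam))

namespace AEC

/-- Universality, up to an isomorphism of the base. -/
theorem exists_universal_emb {K : AEC L}
    {μ : Cardinal.{u}} {N N' N₀ N₁ : Mod L} {e : ZFSet.{u} → ZFSet.{u}}
    (huniv : K.IsUniversalOver μ N₀ N₁) (he : K.Emb e N N₀)
    (hs : Set.SurjOn e N.carrier N₀.carrier) (hle : K.le N N') (hN' : K.InCard μ N') :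
    ∃ h, K.Emb h N' N₁ ∧ Set.EqOn h e N.carrier := by
  have hinv : Set.LeftInvOn (Function.invFunOn e N.carrier) e N.carrier :=
    he.injOn.leftInvOn_invFunOn
  obtain ⟨M, J, hM, hJ, hMc, hJid⟩ := ((he.inverse hs hinv).mono_right hle).exists_rename'
  obtain ⟨f, hf, hfid⟩ := huniv.2.2.2 M (hN'.of_emb hJ hMc) hM
  obtain ⟨F, hF, hFv⟩ := hf.exists_emb
  refine ⟨F ∘ J, hF.comp hJ, fun x hx => ?_⟩
  have h1 : J (Function.invFunOn e N.carrier (e x)) = e x := hJid (he.mapsTo hx)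
  rw [hinv hx] at h1
  have hex := he.mapsTo hx
  rw [Function.comp_apply, h1]
  exact (hFv ⟨e x, (K.isSub hM).subset hex⟩).symm.trans (hfid _ hex)

end AEC

/-! ### The main construction of length `λ⁺` -/

namespace PreFrame

variable {K : AEC L} {lam : Cardinal.{u}} {s : PreFrame K lam}

open AEC

theorem DNF.trans_of_le (htrans : s.Transitivity) {A B C D E : Mod L} {b : ZFSet.{u}}
    {hBD : K.le B D} {hCE : K.le C E} {hb : b ∈ D.carrier} {hb' : b ∈ E.carrier}
    (h : s.DNF (tp hBD b hb) A) (h' : s.DNF (tp hCE b hb') B) (hDE : K.le D E) :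
    s.DNF (tp hCE b hb') A := by
  obtain ⟨hA, hB, hAB⟩ := h.inCard
  obtain ⟨-, hC, hBC⟩ := h'.inCard
  refine htrans A B C hBC _ hA hB hC hAB h' ?_
  rw [tp_eq_of_le hBD hDE hb] at h
  exact h

/-- One step of the main construction. -/
theorem exists_step (hamalg : K.HasAmalgamation lam) (htrans : s.Transitivity)
    (hext : s.Extension) {A₀ N₀ N₁ : Mod L} {b : ZFSet.{u}} (hN₀ : K.IsSaturated lam N₀)
    {U : Set ZFSet.{u}} (hU : Cardinal.lift.{u + 1} (Order.succ lam) ≤ #U)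
    {A B : Mod L} {hAB : K.le A B} {hb : b ∈ B.carrier} (hB : K.InCard lam B)
    (hBU : B.carrier ⊆ U) (hd : s.DNF (tp hAB b hb) A₀) {e : ZFSet.{u} → ZFSet.{u}}
    (he : K.Emb e A N₀) {x : ZFSet.{u}} (hx : x ∈ N₀.carrier)
    (guess : (ZFSet.{u} → ZFSet.{u}) → Prop)
    (hguess : ∀ k k', guess k → guess k' → Set.EqOn k k' B.carrier) :
    ∃ (P Q : Mod L) (e' : ZFSet.{u} → ZFSet.{u}) (hPQ : K.le P Q) (hb : b ∈ Q.carrier),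
      K.InCard lam P ∧ K.InCard lam Q ∧ K.le A P ∧ K.le B Q ∧ Q.carrier ⊆ U ∧
      s.DNF (tp hPQ b hb) A₀ ∧ K.Emb e' P N₀ ∧ Set.EqOn e' e A.carrier ∧ x ∈ e' '' P.carrier ∧
      (¬ s.IsUniquenessTriple A B b → ∀ k, guess k →
        ¬ ∃ h, K.Emb h Q N₁ ∧ Set.EqOn h k B.carrier ∧ Set.EqOn h e' P.carrier) := by
  have hbasic := isBasicTriple_of_dnf hB hd
  have hA := hbasic.1
  have hUX : ∀ X, K.InCard lam X → Cardinal.lift.{u + 1} lam ≤ #(U \ X.carrier : Set ZFSet.{u}) :=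
    fun X hX => lift_le_mk_sdiff s.aleph0_le hU hX.2.le
  obtain ⟨C, D, e₁, hCD, hbD, hD, hAC, hBD, hDU, hd₁, he₁, hee₁, hno⟩ :
      ∃ (C D : Mod L) (e₁ : ZFSet.{u} → ZFSet.{u}) (hCD : K.le C D) (hb : b ∈ D.carrier),
        K.InCard lam D ∧ K.le A C ∧ K.le B D ∧ D.carrier ⊆ U ∧ s.DNF (tp hCD b hb) A ∧
        K.Emb e₁ C N₀ ∧ Set.EqOn e₁ e A.carrier ∧
        (¬ s.IsUniquenessTriple A B b → ∀ k, guess k →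
          ¬ ∃ h, K.Emb h D N₁ ∧ Set.EqOn h k B.carrier ∧ Set.EqOn h e₁ C.carrier) := by
    -- Guesses agree on `B`, so defeating one of them defeats all. With nothing to defeat, the pair
    -- is left as it is.
    by_cases hcase : ¬ s.IsUniquenessTriple A B b ∧ ∃ k, guess k
    · obtain ⟨hnu, k, hk⟩ := hcase
      obtain ⟨C, D, e₁, hCD, hbD, hD, hAC, hBD, hDU, hd₁, he₁, hee₁, hno⟩ :=
        exists_not_extendable (N₁ := N₁) hamalg hbasic hnu hN₀ he k hBU (hUX B hB)
      refine ⟨C, D, e₁, hCD, hbD, hD, hAC, hBD, hDU, hd₁, he₁, hee₁, fun _ k' hk' => ?_⟩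
      rintro ⟨h, hh, hk1, hc1⟩
      exact hno ⟨h, hh, fun y hy => (hk1 hy).trans (hguess _ _ hk' hk hy), hc1⟩
    · exact ⟨A, B, e, hAB, hb, hB, K.refl hA.1, K.refl hB.1, hBU,
        hext.dnf_self hA hd.mem_bs, he, fun _ _ => rfl,
        fun hnu k hk => absurd ⟨hnu, k, hk⟩ hcase⟩
  obtain ⟨P, Q, e₂, hPQ, hbQ, hP, hQ, hCP, hDQ, hQU, hd₂, he₂, hee₂, hxe⟩ :=
    exists_extension_mem hamalg hext hd₁.inCard.2.1 hD hd₁.mem_bs he₁ hx hDU (hUX D hD)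
  refine ⟨P, Q, e₂, hPQ, hbQ, hP, hQ, K.trans hAC hCP, K.trans hBD hDQ, hQU,
    DNF.trans_of_le htrans hd (DNF.trans_of_le htrans hd₁ hd₂ hDQ) (K.trans hBD hDQ), he₂,
    fun y hy => (hee₂ ((K.isSub hAC).subset hy)).trans (hee₁ hy), hxe, fun hnu k hk => ?_⟩
  rintro ⟨h, hh, hk1, hc1⟩
  -- Enlarging the pair to reach `x` does no harm: an embedding of `Q` would restrict to a forbidden
  -- one of `D`.
  exact hno hnu k hk ⟨h, hh.mono_left hDQ, hk1,
    fun y hy => (hc1 ((K.isSub hCP).subset hy)).trans (hee₂ hy)⟩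

/-- The main construction, with guesses given in advance. -/
theorem exists_guessing_chain (hamalg : K.HasAmalgamation lam) (htrans : s.Transitivity)
    (hext : s.Extension) (hcont : s.Continuity) {A B N₀ N₁ : Mod L} {b : ZFSet.{u}}
    (hbasic : s.IsBasicTriple A B b) (hN₀ : K.IsSaturated lam N₀) (hA : K.le A N₀)
    {U : Set ZFSet.{u}} (hBU : B.carrier ⊆ U)
    (hU : Cardinal.lift.{u + 1} (Order.succ lam) ≤ #U) (x : Ordinal.{u} → ZFSet.{u})
    (guess : Ordinal.{u} → Mod L → (ZFSet.{u} → ZFSet.{u}) → Prop)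
    (hguess : ∀ α Q k k', guess α Q k → guess α Q k' → Set.EqOn k k' Q.carrier) :
    ∃ σ : Ordinal.{u} → Stage L, (σ 0).P = A ∧ (σ 0).Q = B ∧ (σ 0).e = id ∧
      (∀ α < (Order.succ lam).ord, Stage.Valid K lam N₀ (σ α)) ∧
      (∀ α < (Order.succ lam).ord, Set.EqOn (σ α).g id (σ α).P.carrier ∧
        (σ α).Q.carrier ⊆ U ∧ ∃ (h : K.le (σ α).P (σ α).Q) (hb : b ∈ (σ α).Q.carrier),
          s.DNF (tp h b hb) A) ∧
      Stage.IsChain K (Order.succ lam).ord σ ∧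
      ∀ α < (Order.succ lam).ord,
        (x α ∈ N₀.carrier → x α ∈ (σ (Order.succ α)).e '' (σ (Order.succ α)).P.carrier) ∧
        (¬ s.IsUniquenessTriple (σ α).P (σ α).Q b → ∀ k, guess α (σ α).Q k →
          ¬ ∃ h, K.Emb h (σ (Order.succ α)).Q N₁ ∧ Set.EqOn h k (σ α).Q.carrier ∧
            Set.EqOn h (σ (Order.succ α)).e (σ (Order.succ α)).P.carrier) := by
  obtain ⟨hAc, hBc, -, -, hAB, hb, hbs⟩ := hbasic
  have hlim : Order.IsSuccLimit (Order.succ lam).ord :=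
    Cardinal.isSuccLimit_ord (s.aleph0_le.trans (Order.le_succ lam))
  have hne : N₀.carrier.Nonempty := by
    rw [← Set.nonempty_coe_sort, ← Cardinal.mk_ne_zero_iff, hN₀.1.2]
    simp
  obtain ⟨σ, h0, hv, hI, hch, hst⟩ := Stage.exists_chain (K := K) (θ := (Order.succ lam).ord)
    s.aleph0_le le_rfl ⟨A, B, id, id⟩
    (fun σ => Set.EqOn σ.g id σ.P.carrier ∧ σ.Q.carrier ⊆ U ∧
      ∃ (h : K.le σ.P σ.Q) (hb : b ∈ σ.Q.carrier), s.DNF (tp h b hb) A)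
    (fun α σ τ => (x α ∈ N₀.carrier → x α ∈ τ.e '' τ.P.carrier) ∧
      (¬ s.IsUniquenessTriple σ.P σ.Q b → ∀ k, guess α σ.Q k →
        ¬ ∃ h, K.Emb h τ.Q N₁ ∧ Set.EqOn h k σ.Q.carrier ∧ Set.EqOn h τ.e τ.P.carrier))
    ⟨hAc, hBc, emb_id hAB, emb_id hA⟩
    ⟨fun _ _ => rfl, hBU, hAB, hb, hext.dnf_self hAc hbs⟩
    (by
      rintro α - σ hv ⟨hg, hQU, hPQ, hbQ, hd⟩
      obtain ⟨y, hy, hyx⟩ : ∃ y ∈ N₀.carrier, x α ∈ N₀.carrier → y = x α := by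
        by_cases h : x α ∈ N₀.carrier
        · exact ⟨x α, h, fun _ => rfl⟩
        · exact ⟨hne.some, hne.some_mem, fun h' => absurd h' h⟩
      obtain ⟨P, Q, e', hPQ', hbQ', hP, hQ, hPP, hQQ, hQU', hd', he', hee, hxe, hno⟩ :=
        exists_step (N₁ := N₁) hamalg htrans hext hN₀ hU hv.Q hQU hd hv.e hy (guess α σ.Q)
          (hguess α σ.Q)
      exact ⟨⟨P, Q, id, e'⟩, ⟨hP, hQ, emb_id hPQ', he'⟩,
        ⟨fun _ _ => rfl, hQU', hPQ', hbQ', hd'⟩, ⟨hPP, hQQ, hg.symm, hee⟩,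
        fun h => hyx h ▸ hxe, hno⟩)
    (by
      intro δ hδ hl σ h0 hv hI hch
      have hP := hch.P δ (Order.lt_succ δ) hl
      have hQ := hch.Q δ (Order.lt_succ δ) hl
      have hle : ∀ α < δ, Stage.Le K (σ α) (σ δ) := fun α hα =>
        hch.le α δ hα.le (Order.lt_succ δ)
      have hg : Set.EqOn (σ δ).g id (σ δ).P.carrier := by
        intro y hy
        obtain ⟨α, hα, hy'⟩ := hP.mem_iff.1 hy
        exact ((hle α hα).g hy').trans ((hI α hα).1 hy')
      -- Carrying the inclusion as the map `g` of the stage makes this an instance of validity at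
      -- the limit.
      have hPQ : K.le (σ δ).P (σ δ).Q := (hv δ le_rfl).g.le_of_id hg
      have hbδ : b ∈ (σ δ).Q.carrier := by
        obtain ⟨-, -, -, hb0, -⟩ := hI 0 hl.bot_lt
        exact (K.isSub (hle 0 hl.bot_lt).Q).subset hb0
      refine ⟨hg, fun y hy => ?_, hPQ, hbδ, ?_⟩
      · obtain ⟨α, hα, hy'⟩ := hQ.mem_iff.1 hy
        exact (hI α hα).2.1 hy'
      · have hA0 : A = (σ 0).P := by rw [h0]
        rw [hA0]
        refine (hcont δ (fun α => (σ α).P) hl hδ hch.incP hch.P (fun α hα => (hv α hα).P)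
          (tp hPQ b hbδ) fun α hα => ?_).2
        obtain ⟨-, -, hPQα, hbα, hd⟩ := hI α hα
        rw [tp_eq_of_le hPQα (hle α hα).Q hbα, hA0] at hd
        exact hd)
  have h0 := h0 hlim.bot_lt
  exact ⟨σ, by rw [h0], by rw [h0], by rw [h0], hv, hI, hch,
    fun α hα => hst α (hlim.succ_lt hα)⟩

/-- Non-forking of the type of a point over the union of a representation. -/
theorem bigDNF_of_chain {A N N' : Mod L} {b : ZFSet.{u}} {As Bs : Ordinal.{u} → Mod L}
    (hAs : IsIncreasing K.le (Order.succ lam).ord As)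
    (hN : IsUnion (Order.succ lam).ord As N)
    (hd : ∀ α < (Order.succ lam).ord, ∃ (h : K.le (As α) (Bs α)) (hb : b ∈ (Bs α).carrier),
      s.DNF (tp h b hb) A)
    (hAsN : ∀ α < (Order.succ lam).ord, K.le (As α) N)
    (hBsN : ∀ α < (Order.succ lam).ord, K.le (Bs α) N')
    (hcard : Cardinal.lift.{u + 1} lam < #N) (hAN : K.le A N) (hle : K.le N N')
    (hb : b ∈ N'.carrier) : s.BigDNF (tp hle b hb) A := by
  have hlim : Order.IsSuccLimit (Order.succ lam).ord :=
    Cardinal.isSuccLimit_ord (s.aleph0_le.trans (Order.le_succ lam))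
  obtain ⟨_, _, hd0⟩ := hd 0 hlim.bot_lt
  refine ⟨hd0.inCard.1, hcard, hAN, fun B hBN hB hAB => ?_⟩
  have : ∀ y : B, ∃ α < (Order.succ lam).ord, (y : ZFSet.{u}) ∈ (As α).carrier := fun y =>
    hN.mem_iff.1 ((K.isSub hBN).subset y.2)
  choose a ha hya using this
  -- By regularity a model of size `λ` inside `N` is contained in one member of the representation,
  -- from which non-forking restricts.
  obtain ⟨β, hβ, hab⟩ := exists_bound s.aleph0_le hB.2.le a ha
  have hBβ : K.le B (As β) := le_of_subset hBN (hAsN β hβ) fun y hy =>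
    (K.isSub (hAs _ _ (hab ⟨y, hy⟩).le hβ)).subset (hya ⟨y, hy⟩)
  obtain ⟨hABβ, hbβ, hdβ⟩ := hd β hβ
  have := hdβ.mono hd0.inCard.1 hB (K.refl hd0.inCard.1.1) hAB hBβ
  rw [show (tp hABβ b hbβ).restrict hBβ = tp (K.trans hBβ hABβ) b hbβ from rfl,
    tp_eq_of_le _ (hBsN β hβ)] at this
  exact this

end PreFrame

end AECFrame

/-! ### The union of the chain and the diamond argument -/

open AECFrame AECFrame.AEC AECFrame.PreFrame in
theorem theorem14p1 {L : FirstOrder.Language.{u, u}} (K : AECFrame.AEC L) (lam : Cardinal.{u})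
    (hlam : ℵ₀ ≤ lam) (hdiamond : AECFrame.Diamond (Order.succ lam))
    (s : AECFrame.PreFrame K lam)
    (hamalg : K.HasAmalgamation lam) (htrans : s.Transitivity)
    (hext : s.Extension) (hcont : s.Continuity)
    (A B : AECFrame.Mod L) (b : ZFSet.{u}) (hbasic : s.IsBasicTriple A B b)
    (N₀ N₁ : AECFrame.Mod L) (hsat : K.IsSaturated lam N₀) (hA : K.lt A N₀)
    (huniv : K.IsUniversalOver (Order.succ lam) N₀ N₁) :
    ∃ (N N' : AECFrame.Mod L) (As Bs : Ordinal.{u} → AECFrame.Mod L) (h : N' ↪[L] N₁),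
      K.InCard (Order.succ lam) N ∧ K.InCard (Order.succ lam) N' ∧
      K.IsRepresentation lam As N ∧ K.IsRepresentation lam Bs N' ∧ K.IsEmb h ∧
      K.lt N N' ∧ b ∈ N'.carrier ∧ b ∉ N.carrier ∧
      K.IsSaturated lam N ∧
      As 0 = A ∧ Bs 0 = B ∧
      (∃ (hle : K.le N N') (hb : b ∈ N'.carrier), s.BigDNF (AECFrame.AEC.tp hle b hb) A) ∧
      (∀ α < (Order.succ lam).ord, s.IsBasicTriple (As α) (Bs α) b) ∧
      IsStationary {α : Set.Iio (Order.succ lam).ord | s.IsUniquenessTriple (As α) (Bs α) b} ∧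
      (∃ (hle : K.le N N') (e : N ≃[L] N₀),
        ∀ x : N, (e x : ZFSet.{u}) = h (AECFrame.Mod.incl (K.isSub hle) x)) ∧
      (∀ x : N', (x : ZFSet.{u}) ∈ A.carrier → (h x : ZFSet.{u}) = x) := by
  have hsucc : ℵ₀ ≤ Order.succ lam := hlam.trans (Order.le_succ lam)
  have hlim : Order.IsSuccLimit (Order.succ lam).ord := Cardinal.isSuccLimit_ord hsucc
  obtain ⟨S, -, hS⟩ := hdiamond
  -- A reservoir of `λ⁺` points containing `B` is fixed now, since the coding must be known before
  -- the chain is built.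
  obtain ⟨V, -, hV⟩ := Cardinal.le_mk_iff_exists_subset.1
    (lift_le_mk_compl B.carrier (Order.succ lam))
  have hU1 : Cardinal.lift.{u + 1} (Order.succ lam) ≤ #(V ∪ B.carrier : Set ZFSet.{u}) :=
    hV.ge.trans (Cardinal.mk_le_mk_of_subset Set.subset_union_left)
  have hU2 : #(V ∪ B.carrier : Set ZFSet.{u}) ≤ Cardinal.lift.{u + 1} (Order.succ lam) :=
    (Cardinal.mk_union_le _ _).trans (Cardinal.add_le_of_le (Cardinal.aleph0_le_lift.2 hsucc) hV.le
      (hbasic.2.1.2.le.trans (Cardinal.lift_le.2 (Order.le_succ lam))))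
  generalize hUdef : V ∪ B.carrier = U at hU1 hU2
  have hBU : B.carrier ⊆ U := hUdef ▸ Set.subset_union_right
  obtain ⟨x, hx⟩ := exists_enumeration hsat.1.2.le
  obtain ⟨code, hcode, hcode_inj⟩ := exists_code hsucc hU2 huniv.2.1.2.le
  obtain ⟨σ, hP0, hQ0, he0, hv, hI, hch, hst⟩ := exists_guessing_chain (N₁ := N₁) hamalg htrans hext
    hcont hbasic hsat hA.1 hBU hU1 x
    -- The guess at `α` is the map on `Q` whose graph is decoded from `S α`, if there is one; it is
    -- then unique on `Q`.
    (fun α Q k => Set.MapsTo k Q.carrier N₁.carrier ∧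
      ∀ y ∈ Q.carrier, ∀ z ∈ N₁.carrier, code y z ∈ S α ↔ z = k y)
    (fun α Q k k' hk hk' y hy => (hk'.2 y hy _ (hk.1 hy)).1 ((hk.2 y hy _ (hk.1 hy)).2 rfl))
  obtain ⟨τ, hle, hP, hQ, hg, he⟩ := hch.exists_union hlim hv
  have hgid : Set.EqOn τ.g id τ.P.carrier := fun y hy => by
    obtain ⟨α, hα, hy'⟩ := hP.mem_iff.1 hy
    exact ((hle α hα).g hy').trans ((hI α hα).1 hy')
  have hNN' : K.le τ.P τ.Q := hg.le_of_id hgid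
  have hsurj : Set.SurjOn τ.e τ.P.carrier N₀.carrier := by
    intro y hy
    obtain ⟨α, hα, rfl⟩ := hx hy
    obtain ⟨z, hz, hzx⟩ := (hst α hα).1 hy
    have hle' := hle _ (hlim.succ_lt hα)
    exact ⟨z, (K.isSub hle'.P).subset hz, (hle'.e hz).trans hzx⟩
  have hNsat : K.IsSaturated lam τ.P := hsat.of_surjOn hlam s.lst_le hamalg he hsurj
  have hNcard := hNsat.1
  have hN'card : K.InCard (Order.succ lam) τ.Q := by
    refine ⟨K.mem_right hNN', le_antisymm
      (hQ.mk_le hsucc (Cardinal.card_ord _).le fun α hα => ?_) ?_⟩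
    · rw [(hv α hα).Q.2]
      exact Cardinal.lift_le.2 (Order.le_succ lam)
    · rw [← hNcard.2]
      exact Cardinal.mk_le_mk_of_subset (K.isSub hNN').subset
  obtain ⟨F, hF, hFe⟩ := exists_universal_emb huniv he hsurj hNN' hN'card
  obtain ⟨h, hh, hhF⟩ := id hF
  obtain ⟨φ, hφ⟩ := he.exists_equiv hsurj
  have hbQ : b ∈ τ.Q.carrier := by
    obtain ⟨-, -, -, hb0, -⟩ := hI 0 hlim.bot_lt
    exact (K.isSub (hle 0 hlim.bot_lt).Q).subset hb0
  have hbP : b ∉ τ.P.carrier := by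
    intro hb
    obtain ⟨α, hα, hb'⟩ := hP.mem_iff.1 hb
    obtain ⟨-, -, _, _, hd⟩ := hI α hα
    exact hd.notMem hb'
  have hAP : K.le A τ.P := hP0 ▸ (hle 0 hlim.bot_lt).P
  refine ⟨τ.P, τ.Q, fun α => (σ α).P, fun α => (σ α).Q, h, hNcard, hN'card,
    ⟨hch.incP, hch.P, fun α hα => (hv α hα).P, hP⟩, ⟨hch.incQ, hch.Q, fun α hα => (hv α hα).Q, hQ⟩,
    hh, ⟨hNN', fun heq => hbP (heq ▸ hbQ)⟩, hbQ, hbP, hNsat, hP0, hQ0, ⟨hNN', hbQ, ?_⟩,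
    fun α hα => ?_, ?_, ⟨hNN', φ, fun y => ?_⟩, fun y hy => ?_⟩
  · exact bigDNF_of_chain hch.incP hP (fun α hα => (hI α hα).2.2) (fun α hα => (hle α hα).P)
      (fun α hα => (hle α hα).Q) (by rw [hNcard.2]; exact Cardinal.lift_lt.2 (Order.lt_succ lam))
      hAP hNN' hbQ
  · obtain ⟨-, -, _, _, hd⟩ := hI α hα
    exact isBasicTriple_of_dnf (hv α hα).Q hd
  · have hQU : ∀ α < (Order.succ lam).ord, ∀ y ∈ (σ α).Q.carrier,
        y ∈ U ∧ y ∈ τ.Q.carrier ∧ F y ∈ N₁.carrier := fun α hα y hy => by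
      have := (K.isSub (hle α hα).Q).subset hy
      exact ⟨(hI α hα).2.1 hy, this, hF.mapsTo this⟩
    have hτU : ∀ y ∈ τ.Q.carrier, y ∈ U := fun y hy => by
      obtain ⟨α, hα, hy'⟩ := hQ.mem_iff.1 hy
      exact (hQU α hα y hy').1
    -- Closing under these bounds ensures that the graph of `F` on `Q α` is coded below `α`.
    have hbd : ∀ β, ∃ c, β < (Order.succ lam).ord → c < (Order.succ lam).ord ∧
        ∀ y ∈ (σ β).Q.carrier, code y (F y) < c := by
      intro β
      by_cases hβ : β < (Order.succ lam).ord
      · obtain ⟨c, hc, hyc⟩ := exists_bound hlam (hv β hβ).Q.2.le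
          (fun y : (σ β).Q => code y (F y)) fun y =>
            hcode _ (hQU β hβ y y.2).1 _ (hQU β hβ y y.2).2.2
        exact ⟨c, fun _ => ⟨hc, fun y hy => hyc ⟨y, hy⟩⟩⟩
      · exact ⟨0, fun h => absurd h hβ⟩
    choose f hf using hbd
    intro t ht
    -- Diamond is applied to the coded graph of `F`, inside the given club `t` met with the closure
    -- points.
    obtain ⟨α, hαS, hαt, hαl, hαf⟩ := hS ((fun y => code y (F y)) '' τ.Q.carrier)
      (by
        rintro _ ⟨y, hy, rfl⟩
        exact hcode y (hτU y hy) _ (hF.mapsTo hy))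
      (ht.inter (cof_Iio_succ_ord_ne hlam)
        (isClub_closurePoints hlam f fun β hβ => (hf β hβ).1))
    refine ⟨α, ?_, hαt⟩
    by_contra hnu
    have hsα := hlim.succ_lt α.2
    -- Here `F` is both the guessed map on `Q α` and the embedding of the next stage that the
    -- construction had excluded.
    refine (hst α α.2).2 hnu F ⟨fun y hy => (hQU α α.2 y hy).2.2, fun y hy z hz => ?_⟩
      ⟨F, hF.mono_left (hle _ hsα).Q, fun _ _ => rfl, fun y hy =>
        (hFe ((K.isSub (hle _ hsα).P).subset hy)).trans ((hle _ hsα).e hy)⟩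
    rw [← show _ = S α from hαS]
    obtain ⟨hyU, hyQ, hFy⟩ := hQU α α.2 y hy
    constructor
    · rintro ⟨⟨y', hy', heq⟩, -⟩
      obtain ⟨rfl, h2⟩ := hcode_inj y' (hτU y' hy') _ (hF.mapsTo hy') y hyU z hz heq
      exact h2.symm
    · rintro rfl
      refine ⟨⟨y, hyQ, rfl⟩, ?_⟩
      -- As `α` is a limit, `y` already occurs in some earlier `Q β`, so the code of `(y, F y)` lies
      -- below `f β ≤ α`.
      obtain ⟨β, hβ, hyβ⟩ := (hch.Q α α.2 hαl).mem_iff.1 hy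
      exact ((hf β (lt_trans hβ α.2)).2 y hyβ).trans_le (hαf β hβ)
  · rw [hφ, hhF]
    exact (hFe y.2).symm
  · rw [hhF, hFe ((K.isSub hAP).subset hy)]
    have := (hle 0 hlim.bot_lt).e (by rw [hP0]; exact hy)
    rwa [he0] at this
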